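/- Let $p>0$ and $\rho\in\mathbb{R}$. A function $u:\mathbb{R}^4\to\mathbb{R}$ is called a normal solution of $$\Delta^2u=(1+|x|^p)e^{4u}\quad\text{in }\mathbb{R}^4 \qquad (1)$$ if $(1+|x|^p)e^{4u}\in L^1(\mathbb{R}^4)$ and there is a constant $c\in\mathbb{R}$ such that, for every $x\in\mathbb{R}^4$, $$u(x)=\frac{1}{8\pi^2}\int_{\mathbb{R}^4}\log\left(\frac{|y|}{|x-y|}\right)(1+|y|^p)e^{4u(y)}\,dy+c,$$ where the integral converges absolutely. Then there exists exactly one radially symmetric normal solution $u$ of (1) with $u(0)=\rho$. This $u$ is of class $C^4$ and satisfies (1) pointwise. -/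

import Mathlib

open MeasureTheory InnerProductSpace

/-- `ℝ⁴` with its Euclidean norm and Lebesgue measure. -/
abbrev R4 : Type := EuclideanSpace ℝ (Fin 4)

/-- `u` is a classical solution of `Δ² u = K e^{4u}` on `ℝ⁴`. -/
structure IsClassicalSolution (K u : R4 → ℝ) : Prop where
  contDiff : ContDiff ℝ 4 u
  eqn : ∀ x : R4, Laplacian.laplacian (Laplacian.laplacian u) x = K x * Real.exp (4 * u x)

/-- `u` is a normal solution of `Δ² u = K e^{4u}` on `ℝ⁴`: `K e^{4u} ∈ L¹(ℝ⁴)` and, for some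
constant `c` and every `x`,
`u x = 1/(8π²) ∫ log (|y| / |x - y|) K(y) e^{4u(y)} dy + c` with a convergent integral. -/
structure IsNormalSolution (K u : R4 → ℝ) : Prop where
  integrable : Integrable (fun y : R4 => K y * Real.exp (4 * u y)) volume
  integrable_kernel : ∀ x : R4,
    Integrable (fun y : R4 => Real.log (‖y‖ / ‖x - y‖) * (K y * Real.exp (4 * u y))) volume
  integral_eq : ∃ c : ℝ, ∀ x : R4,
    u x = 1 / (8 * Real.pi ^ 2) *
      (∫ y : R4, Real.log (‖y‖ / ‖x - y‖) * (K y * Real.exp (4 * u y))) + c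

/-- `u` is radially symmetric: its value depends only on `|x|`. -/
def IsRadial (u : R4 → ℝ) : Prop :=
  ∀ x y : R4, ‖x‖ = ‖y‖ → u x = u y

/-! Write a radial `u` as U(|x|²) and put F(t) = (1 + t^(p/2)) e^{4U(t)}. Averaging the logarithm
over spheres (`integral_log_potential`) turns the normal representation into U(τ) = ρ - (1/8) ∫
K(τ,t) F(t) dt, where K = `radialLogKernel` satisfies 0 ≤ K ≤ τ/4. With G = τ/32 - K/8 this says
U(τ) = ρ + aτ/8 + ∫ G(τ,t) F(t) dt together with a + ¼∫F = 0: the radial initial value problem with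
Δu(0) = a, and the condition that Δu tends to 0 at infinity. Since G ≥ 0 and G = 0 for t ≥ τ, its
solutions are monotone in a (`IsShootingSol.mono`).

Existence: consider the a admitting a solution with a + ¼∫F ≤ 0. Very negative a qualify, 0 is an
upper bound, and the supremum is attained by monotone convergence. If the inequality were strict at
the maximum, F would decay exponentially, which leaves room for a supersolution with a larger a
(`IsShootingSol.exists_super_of_mass_lt`); monotone iteration (`IsShootingSuper.exists_sol`) would
then contradict maximality. Hence equality holds. The mass ∫ t F(t) dt is finite: a large mass would
force a power decay of e^{4U} that makes it finite. So this solution is normal.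

Regularity: off the origin the potential is differentiated explicitly. At the origin F is merely
continuous; after removing F(0) the derivatives obey little-o bounds that give C⁴, and the equation
extends by continuity.

Uniqueness: for two solutions with a ≤ b, comparison gives U ≤ V, while the representation with -K
gives U ≥ V. -/

/-! ### Angular averages of the logarithmic kernel -/

lemma integral_cos_int_mul (m : ℤ) (hm : m ≠ 0) :
    ∫ θ in (0 : ℝ)..Real.pi, Real.cos (m * θ) = 0 := by
  have hm' : (m : ℝ) ≠ 0 := by exact_mod_cast hm
  rw [intervalIntegral.integral_comp_mul_left (fun x => Real.cos x) hm']
  simp [integral_cos, Real.sin_int_mul_pi]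

/-- As sin² θ = (1 - cos 2θ)/2, orthogonality of cosines leaves only frequency 2. This is why the
averages of the logarithm have a closed form. -/
lemma integral_sin_sq_mul_cos_nat (n : ℕ) (hn : n ≠ 0) :
    ∫ θ in (0 : ℝ)..Real.pi, Real.sin θ ^ 2 * Real.cos (n * θ) =
      if n = 2 then -(Real.pi / 4) else 0 := by
  have key : ∀ θ : ℝ, Real.sin θ ^ 2 * Real.cos (n * θ) =
      1 / 2 * Real.cos (((n : ℤ) : ℝ) * θ) - 1 / 4 * Real.cos ((((n : ℤ) + 2 : ℤ) : ℝ) * θ)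
        - 1 / 4 * Real.cos ((((n : ℤ) - 2 : ℤ) : ℝ) * θ) := by
    intro θ
    push_cast
    rw [add_mul, sub_mul, Real.cos_add, Real.cos_sub, Real.cos_two_mul, Real.sin_sq]
    ring
  have hc : ∀ (c : ℝ) (m : ℤ), IntervalIntegrable (fun θ : ℝ => c * Real.cos ((m : ℝ) * θ)) volume
      0 Real.pi := fun c m => (Continuous.intervalIntegrable (by fun_prop) _ _)
  simp_rw [key]
  rw [intervalIntegral.integral_sub ((hc _ _).sub (hc _ _)) (hc _ _),
    intervalIntegral.integral_sub (hc _ _) (hc _ _)]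
  simp only [intervalIntegral.integral_const_mul]
  rw [integral_cos_int_mul n (by exact_mod_cast hn), integral_cos_int_mul (n + 2) (by omega)]
  split_ifs with h
  · subst h
    simp
    ring
  · rw [integral_cos_int_mul (n - 2) (by omega)]
    simp

/-- The argument of the logarithm is |1 - q e^{iθ}|², so this is the real part of the Taylor series
of log(1 - z). -/
lemma hasSum_log_one_sub_two_mul_cos {q : ℝ} (hq0 : 0 ≤ q) (hq1 : q < 1) (θ : ℝ) :
    HasSum (fun n : ℕ => -2 * (q ^ n * Real.cos (n * θ) / n))
      (Real.log (1 - 2 * q * Real.cos θ + q ^ 2)) := by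
  set z : ℂ := q * Complex.exp (θ * Complex.I) with hz
  have hnorm : ‖z‖ < 1 := by
    simp [hz, Complex.norm_exp_ofReal_mul_I, abs_of_nonneg hq0, hq1]
  have h := (Complex.hasSum_re (Complex.hasSum_taylorSeries_neg_log hnorm)).mul_left (-2)
  have hre : (-2 : ℝ) * (-Complex.log (1 - z)).re =
      Real.log (1 - 2 * q * Real.cos θ + q ^ 2) := by
    have h1 : ‖1 - z‖ ^ 2 = 1 - 2 * q * Real.cos θ + q ^ 2 := by
      rw [← Complex.normSq_eq_norm_sq, Complex.normSq_apply]
      simp [hz, Complex.exp_ofReal_mul_I_re, Complex.exp_ofReal_mul_I_im]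
      nlinarith [Real.sin_sq_add_cos_sq θ]
    rw [← h1, Complex.neg_re, Complex.log_re, Real.log_pow]
    push_cast; ring
  rw [hre] at h
  refine h.congr_fun ?_
  intro n
  have : z ^ n / n = ((q ^ n / n : ℝ) : ℂ) * Complex.exp ((n * θ : ℝ) * Complex.I) := by
    rw [hz, mul_pow, ← Complex.exp_nat_mul]
    push_cast
    ring_nf
  rw [this, Complex.re_ofReal_mul, Complex.exp_ofReal_mul_I_re]
  ring

lemma integral_sin_sq_mul_log {q : ℝ} (hq0 : 0 ≤ q) (hq1 : q < 1) :
    ∫ θ in (0 : ℝ)..Real.pi, Real.sin θ ^ 2 * Real.log (1 - 2 * q * Real.cos θ + q ^ 2) =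
      Real.pi * q ^ 2 / 4 := by
  have h := intervalIntegral.hasSum_integral_of_dominated_convergence (μ := volume)
    (a := 0) (b := Real.pi)
    (F := fun (n : ℕ) (θ : ℝ) => Real.sin θ ^ 2 * (-2 * (q ^ n * Real.cos (n * θ) / n)))
    (f := fun θ => Real.sin θ ^ 2 * Real.log (1 - 2 * q * Real.cos θ + q ^ 2))
    (fun n _ => 2 * q ^ n) (fun n => (Continuous.aestronglyMeasurable (by fun_prop)))
    (fun n => Filter.Eventually.of_forall fun θ _ => ?_)
    (Filter.Eventually.of_forall fun θ _ => (summable_geometric_of_lt_one hq0 hq1).mul_left 2)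
    (by simp) (Filter.Eventually.of_forall fun θ _ =>
      (hasSum_log_one_sub_two_mul_cos hq0 hq1 θ).mul_left _)
  · have h2 : ∀ n : ℕ, (∫ θ in (0 : ℝ)..Real.pi,
        Real.sin θ ^ 2 * (-2 * (q ^ n * Real.cos (n * θ) / n))) =
        if n = 2 then Real.pi * q ^ 2 / 4 else 0 := by
      intro n
      -- The term n = 0 is zero because division by 0 gives 0.
      rcases eq_or_ne n 0 with rfl | hn
      · simp
      have : ∀ θ : ℝ, Real.sin θ ^ 2 * (-2 * (q ^ n * Real.cos (n * θ) / n)) =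
          (-2 * q ^ n / n) * (Real.sin θ ^ 2 * Real.cos (n * θ)) := fun θ => by ring
      simp_rw [this]
      rw [intervalIntegral.integral_const_mul, integral_sin_sq_mul_cos_nat n hn]
      split_ifs with h
      · subst h; push_cast; ring
      · simp
    simp_rw [h2] at h
    exact h.unique (hasSum_ite_eq 2 _)
  · rw [Real.norm_eq_abs, abs_mul, abs_mul, abs_div, abs_mul, abs_of_nonneg (sq_nonneg _),
      abs_of_nonneg (pow_nonneg hq0 n)]
    have h1 : Real.sin θ ^ 2 ≤ 1 := Real.sin_sq_le_one θ
    have h2 : q ^ n * |Real.cos (n * θ)| / |(n : ℝ)| ≤ q ^ n := by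
      rcases eq_or_ne n 0 with rfl | hn
      · simp
      have : (1 : ℝ) ≤ |(n : ℝ)| := by
        rw [Nat.abs_cast]; exact_mod_cast Nat.one_le_iff_ne_zero.mpr hn
      rw [div_le_iff₀ (by linarith)]
      exact mul_le_mul_of_nonneg_left ((Real.abs_cos_le_one _).trans this) (pow_nonneg hq0 n)
    have h3 : 0 ≤ q ^ n * |Real.cos (n * θ)| / |(n : ℝ)| := by positivity
    have : |(-2 : ℝ)| = 2 := by norm_num
    rw [this]
    nlinarith [sq_nonneg (Real.sin θ)]

/-- `t` times the average of `log (|x - y| / |y|)` over the sphere `|y|² = t` in `ℝ⁴`, where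
`|x|² = τ`. -/
noncomputable def radialLogKernel (τ t : ℝ) : ℝ :=
  if t < τ then t / 2 * Real.log (τ / t) + t ^ 2 / (4 * τ) else τ / 4

lemma integral_sin_sq_zero_pi : ∫ θ in (0 : ℝ)..Real.pi, Real.sin θ ^ 2 = Real.pi / 2 := by
  simp [integral_sin_sq]

lemma intervalIntegrable_sin_sq_mul_log {q : ℝ} (hq0 : 0 ≤ q) (hq1 : q < 1) :
    IntervalIntegrable (fun θ => Real.sin θ ^ 2 * Real.log (1 - 2 * q * Real.cos θ + q ^ 2))
      volume 0 Real.pi := by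
  refine (Continuous.mul (by fun_prop) (Continuous.log (by fun_prop) fun θ => ?_)).intervalIntegrable
    _ _
  nlinarith [Real.cos_le_one θ, sq_nonneg (1 - q), mul_pos (sub_pos.2 hq1) (sub_pos.2 hq1)]

/-- Factoring out the larger of r and s leaves the series with ratio q < 1; for s = r the ratio
would be 1. -/
lemma integral_sin_sq_mul_log_div {r s : ℝ} (hr : 0 ≤ r) (hs : 0 < s) (hrs : s ≠ r) :
    ∫ θ in (0 : ℝ)..Real.pi,
      Real.sin θ ^ 2 * Real.log (s ^ 2 / (r ^ 2 - 2 * r * s * Real.cos θ + s ^ 2)) =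
      -(Real.pi * radialLogKernel (r ^ 2) (s ^ 2) / s ^ 2) := by
  have hpos : ∀ {q : ℝ}, 0 ≤ q → q < 1 → ∀ θ, 1 - 2 * q * Real.cos θ + q ^ 2 ≠ 0 := by
    intro q hq0 hq1 θ
    nlinarith [Real.cos_le_one θ, sq_nonneg (1 - q), mul_pos (sub_pos.2 hq1) (sub_pos.2 hq1)]
  unfold radialLogKernel
  rcases lt_or_gt_of_ne hrs with h | h
  · have hr0 : 0 < r := hs.trans h
    have hq0 : 0 ≤ s / r := by positivity
    have hq1 : s / r < 1 := (div_lt_one hr0).2 h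
    have e : ∀ θ, Real.sin θ ^ 2 *
        Real.log (s ^ 2 / (r ^ 2 - 2 * r * s * Real.cos θ + s ^ 2)) =
        Real.log (s ^ 2 / r ^ 2) * Real.sin θ ^ 2 - Real.sin θ ^ 2 *
          Real.log (1 - 2 * (s / r) * Real.cos θ + (s / r) ^ 2) := by
      intro θ
      have : s ^ 2 / (r ^ 2 - 2 * r * s * Real.cos θ + s ^ 2) =
          (s ^ 2 / r ^ 2) / (1 - 2 * (s / r) * Real.cos θ + (s / r) ^ 2) := by
        rw [div_div]; congr 1; field_simp
      rw [this, Real.log_div (by positivity) (hpos hq0 hq1 θ)]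
      ring
    simp_rw [e]
    rw [intervalIntegral.integral_sub (Continuous.intervalIntegrable (by fun_prop) _ _)
      (intervalIntegrable_sin_sq_mul_log hq0 hq1), integral_sin_sq_mul_log hq0 hq1,
      intervalIntegral.integral_const_mul, integral_sin_sq_zero_pi,
      if_pos (pow_lt_pow_left₀ h hs.le two_ne_zero), Real.log_div (by positivity) (by positivity),
      Real.log_div (by positivity) (by positivity)]
    field_simp
    ring
  · have hq0 : 0 ≤ r / s := by positivity
    have hq1 : r / s < 1 := (div_lt_one hs).2 h
    have e : ∀ θ, Real.sin θ ^ 2 *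
        Real.log (s ^ 2 / (r ^ 2 - 2 * r * s * Real.cos θ + s ^ 2)) =
        -(Real.sin θ ^ 2 * Real.log (1 - 2 * (r / s) * Real.cos θ + (r / s) ^ 2)) := by
      intro θ
      have : s ^ 2 / (r ^ 2 - 2 * r * s * Real.cos θ + s ^ 2) =
          (1 - 2 * (r / s) * Real.cos θ + (r / s) ^ 2)⁻¹ := by
        rw [← one_div, div_eq_div_iff, ]
        · field_simp
          ring
        · have := hpos hq0 hq1 θ
          contrapose! this
          field_simp
          linarith
        · exact hpos hq0 hq1 θ
      rw [this, Real.log_inv]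
      ring
    simp_rw [e]
    rw [intervalIntegral.integral_neg, integral_sin_sq_mul_log hq0 hq1,
      if_neg (not_lt.2 (pow_le_pow_left₀ hr h.le 2))]
    field_simp

/-! ### Axial polar coordinates on ℝ⁴ -/

lemma lintegral_fun_norm_addHaar {E : Type*} [NormedAddCommGroup E] [NormedSpace ℝ E]
    [MeasurableSpace E] [BorelSpace E] [FiniteDimensional ℝ E] [Nontrivial E]
    (μ : Measure E) [μ.IsAddHaarMeasure] {f : ℝ → ENNReal} (hf : Measurable f) :
    ∫⁻ x, f ‖x‖ ∂μ = Module.finrank ℝ E * μ (Metric.ball 0 1) *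
      ∫⁻ y in Set.Ioi (0 : ℝ), ENNReal.ofReal (y ^ (Module.finrank ℝ E - 1)) * f y := by
  calc
    ∫⁻ x, f ‖x‖ ∂μ = ∫⁻ x : ({(0)}ᶜ : Set E), f ‖x.1‖ ∂(μ.comap (↑)) := by
      rw [lintegral_subtype_comap (measurableSet_singleton _).compl fun x ↦ f ‖x‖,
        restrict_compl_singleton]
    _ = ∫⁻ x, f x.2 ∂μ.toSphere.prod (.volumeIoiPow (Module.finrank ℝ E - 1)) := by
      simpa using μ.measurePreserving_homeomorphUnitSphereProd.lintegral_comp_emb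
        (Homeomorph.measurableEmbedding _) (f ∘ Subtype.val ∘ Prod.snd)
    _ = μ.toSphere Set.univ *
        ∫⁻ x : Set.Ioi (0 : ℝ), f x ∂.volumeIoiPow (Module.finrank ℝ E - 1) := by
      rw [lintegral_prod _ (by fun_prop)]
      simp [mul_comm]
    _ = _ := by
      rw [Measure.toSphere_apply_univ, Measure.volumeIoiPow,
        lintegral_withDensity_eq_lintegral_mul _ (by fun_prop) (by fun_prop)]
      simp only [Pi.mul_apply]
      rw [lintegral_subtype_comap measurableSet_Ioi
        (fun y => ENNReal.ofReal (y ^ (Module.finrank ℝ E - 1)) * f y)]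

/-- Coordinates of a point of `ℝ⁴` with respect to the first axis: the height along the axis and
the distance to the axis. -/
noncomputable def axialCoord (y : R4) : ℝ × ℝ :=
  (y 0, ‖WithLp.toLp 2 (fun i : Fin 3 => y i.succ)‖)

lemma measurable_axialCoord : Measurable axialCoord := by
  unfold axialCoord
  refine Measurable.prodMk (by fun_prop) ?_
  refine (Continuous.norm ?_).measurable
  fun_prop

/-- Spherical coordinates in the three directions orthogonal to the axis (unit sphere of area 4π),
then planar polar coordinates in the half-plane of height and distance: the weight is 4π (s sin θ)²
s. -/
lemma lintegral_axialCoord {f : ℝ × ℝ → ENNReal} (hf : Measurable f) :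
    ∫⁻ y : R4, f (axialCoord y) =
      ∫⁻ p in Set.Ioi (0 : ℝ) ×ˢ Set.Ioo (0 : ℝ) Real.pi,
        ENNReal.ofReal (4 * Real.pi * p.1 ^ 3 * Real.sin p.2 ^ 2) *
          f (p.1 * Real.cos p.2, p.1 * Real.sin p.2) := by
  have h3 : ∀ t : ℝ, ∫⁻ z : Fin 3 → ℝ, f (t, ‖WithLp.toLp 2 z‖) =
      ENNReal.ofReal (4 * Real.pi) * ∫⁻ ρ in Set.Ioi (0 : ℝ), ENNReal.ofReal (ρ ^ 2) * f (t, ρ) := by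
    intro t
    have hm : Measurable fun ρ : ℝ => f (t, ρ) := hf.comp (by fun_prop)
    rw [(PiLp.volume_preserving_toLp (Fin 3)).lintegral_comp
      (f := fun z : EuclideanSpace ℝ (Fin 3) => f (t, ‖z‖)) (hm.comp measurable_norm)]
    rw [lintegral_fun_norm_addHaar volume hm, EuclideanSpace.volume_ball_fin_three]
    simp only [finrank_euclideanSpace, Fintype.card_fin]
    congr 1
    rw [ENNReal.ofReal_one, one_pow, one_mul, ← ENNReal.ofReal_natCast 3,
      ← ENNReal.ofReal_mul (by positivity)]
    congr 1
    push_cast; ring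
  have hsplit : ∫⁻ y : R4, f (axialCoord y) =
      ∫⁻ t : ℝ, ∫⁻ z : Fin 3 → ℝ, f (t, ‖WithLp.toLp 2 z‖) := by
    rw [← (PiLp.volume_preserving_toLp (Fin 4)).lintegral_comp
      (f := fun y : R4 => f (axialCoord y)) (hf.comp measurable_axialCoord)]
    have hm : Measurable fun q : ℝ × (Fin 3 → ℝ) => f (q.1, ‖WithLp.toLp 2 q.2‖) := by
      refine hf.comp (Measurable.prodMk (by fun_prop) (Continuous.norm ?_).measurable)
      fun_prop
    have := (volume_preserving_piFinSuccAbove (fun _ : Fin 4 => ℝ) 0).lintegral_comp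
      (f := fun q : ℝ × (Fin 3 → ℝ) => f (q.1, ‖WithLp.toLp 2 q.2‖)) hm
    rw [Measure.volume_eq_prod, lintegral_prod _ hm.aemeasurable] at this
    rw [← this]
    rfl
  rw [hsplit]
  simp_rw [h3]
  have hm2 : Measurable fun q : ℝ × ℝ => ENNReal.ofReal (q.2 ^ 2) * f q := by fun_prop
  -- The half-plane becomes an indicator, so that polar coordinates of the whole plane apply; it
  -- later cuts the angles (-π, π) down to (0, π).
  have hm3 : Measurable fun q : ℝ × ℝ =>
      (Set.univ ×ˢ Set.Ioi (0 : ℝ)).indicator (fun q => ENNReal.ofReal (q.2 ^ 2) * f q) q :=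
    hm2.indicator (MeasurableSet.univ.prod measurableSet_Ioi)
  have hind : ∀ t : ℝ, (∫⁻ ρ in Set.Ioi (0 : ℝ), ENNReal.ofReal (ρ ^ 2) * f (t, ρ)) =
      ∫⁻ ρ, (Set.univ ×ˢ Set.Ioi (0 : ℝ)).indicator
        (fun q : ℝ × ℝ => ENNReal.ofReal (q.2 ^ 2) * f q) (t, ρ) := by
    intro t
    rw [← lintegral_indicator measurableSet_Ioi]
    congr 1
    ext ρ
    simp [Set.indicator]
  simp_rw [hind]
  rw [lintegral_const_mul _ (by exact hm3.lintegral_prod_right'),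
    ← lintegral_prod _ hm3.aemeasurable, ← Measure.volume_eq_prod,
    ← lintegral_comp_polarCoord_symm, ← lintegral_const_mul _ (by
      exact Measurable.smul (f := fun p : ℝ × ℝ => ENNReal.ofReal p.1) (by fun_prop)
        (hm3.comp continuous_polarCoord_symm.measurable)),
    ← lintegral_indicator (by
      simp only [polarCoord_target]; exact measurableSet_Ioi.prod measurableSet_Ioo),
    ← lintegral_indicator (measurableSet_Ioi.prod measurableSet_Ioo)]
  congr 1
  ext ⟨s, θ⟩
  simp only [polarCoord_target, polarCoord_symm_apply, Set.indicator, Set.mem_prod, Set.mem_Ioi,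
    Set.mem_Ioo, Set.mem_univ, true_and, smul_eq_mul]
  by_cases hs : 0 < s
  swap
  · simp [hs]
  by_cases hθ : 0 < θ ∧ θ < Real.pi
  · have h1 : -Real.pi < θ := by linarith [Real.pi_pos]
    have h2 : 0 < s * Real.sin θ := mul_pos hs (Real.sin_pos_of_pos_of_lt_pi hθ.1 hθ.2)
    rw [if_pos ⟨hs, h1, hθ.2⟩, if_pos h2, if_pos ⟨hs, hθ⟩, ← mul_assoc, ← mul_assoc,
      ← ENNReal.ofReal_mul (by positivity), ← ENNReal.ofReal_mul (by positivity)]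
    congr 2
    ring
  · rw [if_neg (c := 0 < s ∧ 0 < θ ∧ θ < Real.pi) (fun h => hθ h.2)]
    split_ifs with h1 h2
    · exfalso
      refine hθ ⟨?_, h1.2.2⟩
      by_contra hc
      have := Real.sin_nonpos_of_nonpos_of_neg_pi_le (not_lt.1 hc) h1.2.1.le
      nlinarith
    · simp
    · rfl

/-- An identity of measures yields both the integrability criterion and the formula for Bochner
integrals. -/
lemma map_axialCoord_volume :
    (volume : Measure R4).map axialCoord =
      (((volume : Measure (ℝ × ℝ)).restrict (Set.Ioi (0 : ℝ) ×ˢ Set.Ioo (0 : ℝ) Real.pi)).withDensity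
        (fun p => ENNReal.ofReal (4 * Real.pi * p.1 ^ 3 * Real.sin p.2 ^ 2))).map
          (fun p => (p.1 * Real.cos p.2, p.1 * Real.sin p.2)) := by
  refine Measure.ext_of_lintegral _ fun f hf => ?_
  rw [lintegral_map hf measurable_axialCoord, lintegral_map hf (by fun_prop),
    lintegral_axialCoord hf, lintegral_withDensity_eq_lintegral_mul _ (by fun_prop)
      (by fun_prop)]
  rfl

lemma ae_toReal_axialDensity (f : ℝ × ℝ → ℝ) :
    (fun p : ℝ × ℝ => (ENNReal.ofReal (4 * Real.pi * p.1 ^ 3 * Real.sin p.2 ^ 2)).toReal •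
        f (p.1 * Real.cos p.2, p.1 * Real.sin p.2)) =ᵐ[(volume : Measure (ℝ × ℝ)).restrict
          (Set.Ioi (0 : ℝ) ×ˢ Set.Ioo (0 : ℝ) Real.pi)]
      fun p => 4 * Real.pi * p.1 ^ 3 * Real.sin p.2 ^ 2 *
        f (p.1 * Real.cos p.2, p.1 * Real.sin p.2) := by
  filter_upwards [ae_restrict_mem (measurableSet_Ioi.prod measurableSet_Ioo)] with p hp
  have : 0 < p.1 := hp.1
  rw [ENNReal.toReal_ofReal (by positivity), smul_eq_mul]

lemma integrable_axialCoord_iff {f : ℝ × ℝ → ℝ} (hf : Measurable f) :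
    Integrable (fun y : R4 => f (axialCoord y)) ↔
      IntegrableOn (fun p : ℝ × ℝ => 4 * Real.pi * p.1 ^ 3 * Real.sin p.2 ^ 2 *
        f (p.1 * Real.cos p.2, p.1 * Real.sin p.2))
        (Set.Ioi (0 : ℝ) ×ˢ Set.Ioo (0 : ℝ) Real.pi) := by
  have h := integrable_map_measure (μ := (volume : Measure R4)) (f := axialCoord) (g := f)
    hf.aestronglyMeasurable measurable_axialCoord.aemeasurable
  rw [Function.comp_def] at h
  rw [← h, map_axialCoord_volume, integrable_map_measure hf.aestronglyMeasurable
    (Measurable.aemeasurable (by fun_prop)), integrable_withDensity_iff_integrable_smul'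
    (by fun_prop) (by simp)]
  exact integrable_congr (ae_toReal_axialDensity f)

lemma integral_axialCoord {f : ℝ × ℝ → ℝ} (hf : Measurable f) :
    ∫ y : R4, f (axialCoord y) =
      ∫ p in Set.Ioi (0 : ℝ) ×ˢ Set.Ioo (0 : ℝ) Real.pi,
        4 * Real.pi * p.1 ^ 3 * Real.sin p.2 ^ 2 *
        f (p.1 * Real.cos p.2, p.1 * Real.sin p.2) := by
  rw [← integral_map (f := f) measurable_axialCoord.aemeasurable hf.aestronglyMeasurable,
    map_axialCoord_volume, integral_map (Measurable.aemeasurable (by fun_prop))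
    hf.aestronglyMeasurable, integral_withDensity_eq_integral_toReal_smul (by fun_prop) (by simp)]
  exact integral_congr_ae (ae_toReal_axialDensity f)

lemma norm_sq_eq_axialCoord (y : R4) : ‖y‖ ^ 2 = (axialCoord y).1 ^ 2 + (axialCoord y).2 ^ 2 := by
  simp only [axialCoord, EuclideanSpace.norm_sq_eq, Fin.sum_univ_succ]
  simp

lemma norm_single_sub_sq_eq_axialCoord (r : ℝ) (y : R4) :
    ‖EuclideanSpace.single 0 r - y‖ ^ 2 =
      (r - (axialCoord y).1) ^ 2 + (axialCoord y).2 ^ 2 := by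
  simp only [axialCoord, EuclideanSpace.norm_sq_eq, Fin.sum_univ_succ]
  simp

/-! ### The logarithmic potential of a radial density -/

lemma log_div_eq_half_log_sq_div (a b : ℝ) :
    Real.log (a / b) = 1 / 2 * Real.log (a ^ 2 / b ^ 2) := by
  rw [← div_pow, Real.log_pow]; push_cast; ring

lemma measurable_radialLogKernel : Measurable fun q : ℝ × ℝ => radialLogKernel q.1 q.2 := by
  unfold radialLogKernel
  refine Measurable.ite (measurableSet_lt measurable_snd measurable_fst) ?_ ?_ <;> fun_prop

lemma integral_Ioi_two_mul_comp_sq (g : ℝ → ℝ) :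
    ∫ s in Set.Ioi (0 : ℝ), 2 * s * g (s ^ 2) = ∫ t in Set.Ioi (0 : ℝ), g t := by
  rw [← integral_comp_rpow_Ioi_of_pos (g := g) (two_pos : (0 : ℝ) < 2)]
  refine setIntegral_congr_fun measurableSet_Ioi fun s _ => ?_
  simp [show (2 : ℝ) - 1 = 1 by norm_num, Real.rpow_one]

lemma integrableOn_Ioi_two_mul_comp_sq_iff (g : ℝ → ℝ) :
    IntegrableOn (fun s => 2 * s * g (s ^ 2)) (Set.Ioi 0) ↔ IntegrableOn g (Set.Ioi 0) := by
  rw [← integrableOn_Ioi_comp_rpow_iff g (two_ne_zero : (2 : ℝ) ≠ 0)]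
  refine integrableOn_congr_fun (fun s _ => ?_) measurableSet_Ioi
  simp [show (2 : ℝ) - 1 = 1 by norm_num, Real.rpow_one]

/-- With t = s², the radial weight s³ ds becomes t dt / 2. The mass on ℝ⁴ is thus a multiple of ∫ t
F(t) dt, as opposed to the quantity ∫ F that governs Δu. -/
lemma integrable_comp_norm_sq_iff (F : ℝ → ℝ) :
    Integrable (fun y : R4 => F (‖y‖ ^ 2)) ↔ IntegrableOn (fun t => t * F t) (Set.Ioi 0) := by
  have h := integrable_fun_norm_addHaar (volume : Measure R4) (f := fun s => F (s ^ 2))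
  rw [h, ← integrableOn_Ioi_two_mul_comp_sq_iff (fun t => t * F t)]
  simp only [finrank_euclideanSpace, Fintype.card_fin, smul_eq_mul]
  constructor
  · intro h
    refine IntegrableOn.congr_fun (h.const_mul 2) (fun s _ => ?_) measurableSet_Ioi
    ring
  · intro h
    refine IntegrableOn.congr_fun (h.const_mul (1 / 2)) (fun s _ => ?_) measurableSet_Ioi
    ring

lemma exists_isometry_apply_eq_single (x : R4) :
    ∃ R : R4 ≃ₗᵢ[ℝ] R4, R x = EuclideanSpace.single 0 ‖x‖ :=
  ⟨_, Submodule.reflection_sub (by simp)⟩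

lemma integral_log_potential_single {F : ℝ → ℝ} (hF : Measurable F) {r : ℝ} (hr : 0 ≤ r)
    (hint : Integrable fun y : R4 =>
      Real.log (‖y‖ / ‖EuclideanSpace.single 0 r - y‖) * F (‖y‖ ^ 2)) :
    ∫ y : R4, Real.log (‖y‖ / ‖EuclideanSpace.single 0 r - y‖) * F (‖y‖ ^ 2) =
      -Real.pi ^ 2 * ∫ t in Set.Ioi (0 : ℝ), radialLogKernel (r ^ 2) t * F t := by
  set f : ℝ × ℝ → ℝ := fun q =>
    1 / 2 * Real.log ((q.1 ^ 2 + q.2 ^ 2) / ((r - q.1) ^ 2 + q.2 ^ 2)) * F (q.1 ^ 2 + q.2 ^ 2)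
    with hf
  have hfm : Measurable f := by
    have : Measurable fun q : ℝ × ℝ => F (q.1 ^ 2 + q.2 ^ 2) := hF.comp (by fun_prop)
    fun_prop
  have hfy : (fun y : R4 => Real.log (‖y‖ / ‖EuclideanSpace.single 0 r - y‖) * F (‖y‖ ^ 2)) =
      fun y => f (axialCoord y) := by
    ext y
    rw [log_div_eq_half_log_sq_div, norm_sq_eq_axialCoord, norm_single_sub_sq_eq_axialCoord]
  rw [hfy] at hint ⊢
  have hpol : ∀ s θ : ℝ, 4 * Real.pi * s ^ 3 * Real.sin θ ^ 2 *
      f (s * Real.cos θ, s * Real.sin θ) = (2 * Real.pi * s ^ 3 * F (s ^ 2)) *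
        (Real.sin θ ^ 2 * Real.log (s ^ 2 / (r ^ 2 - 2 * r * s * Real.cos θ + s ^ 2))) := by
    intro s θ
    have h1 : (s * Real.cos θ) ^ 2 + (s * Real.sin θ) ^ 2 = s ^ 2 := by
      nlinarith [Real.sin_sq_add_cos_sq θ]
    have h2 : (r - s * Real.cos θ) ^ 2 + (s * Real.sin θ) ^ 2 =
        r ^ 2 - 2 * r * s * Real.cos θ + s ^ 2 := by
      nlinarith [Real.sin_sq_add_cos_sq θ]
    simp only [hf, h1, h2]
    ring
  rw [integral_axialCoord hfm, Measure.volume_eq_prod,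
    setIntegral_prod _ ((integrable_axialCoord_iff hfm).1 hint)]
  simp only [hpol]
  rw [← integral_Ioi_two_mul_comp_sq (fun t => radialLogKernel (r ^ 2) t * F t), ← integral_const_mul]
  refine setIntegral_congr_ae measurableSet_Ioi ?_
  -- The sphere through the singularity, where the angular formula is not available, is negligible.
  have hne : ∀ᵐ s : ℝ, s ≠ r := by simp [ae_iff, measure_singleton]
  filter_upwards [hne] with s hsr hs
  have hs : 0 < s := hs
  rw [integral_const_mul, ← integral_Ioc_eq_integral_Ioo,
    ← intervalIntegral.integral_of_le Real.pi_pos.le, integral_sin_sq_mul_log_div hr hs hsr]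
  field_simp

/-- The logarithmic potential of a radial density on `ℝ⁴`. -/
lemma integral_log_potential {F : ℝ → ℝ} (hF : Measurable F) (x : R4)
    (hint : Integrable fun y : R4 => Real.log (‖y‖ / ‖x - y‖) * F (‖y‖ ^ 2)) :
    ∫ y : R4, Real.log (‖y‖ / ‖x - y‖) * F (‖y‖ ^ 2) =
      -Real.pi ^ 2 * ∫ t in Set.Ioi (0 : ℝ), radialLogKernel (‖x‖ ^ 2) t * F t := by
  obtain ⟨R, hR⟩ := exists_isometry_apply_eq_single x
  have hcomp : (fun y : R4 => Real.log (‖y‖ / ‖x - y‖) * F (‖y‖ ^ 2)) =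
      fun y => (fun y : R4 => Real.log (‖y‖ / ‖EuclideanSpace.single 0 ‖x‖ - y‖) * F (‖y‖ ^ 2))
        (R y) := by
    ext y
    simp only [← hR, ← map_sub, R.norm_map]
  have hmp : MeasurePreserving R volume volume := R.measurePreserving
  rw [hcomp] at hint ⊢
  have hint' := (hmp.integrable_comp_emb R.toHomeomorph.measurableEmbedding
    (g := fun y : R4 => Real.log (‖y‖ / ‖EuclideanSpace.single 0 ‖x‖ - y‖) * F (‖y‖ ^ 2))).1 hint
  rw [hmp.integral_comp R.toHomeomorph.measurableEmbedding
    (fun y : R4 => Real.log (‖y‖ / ‖EuclideanSpace.single 0 ‖x‖ - y‖) * F (‖y‖ ^ 2))]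
  exact integral_log_potential_single hF (norm_nonneg x) hint'

lemma integrableOn_log_norm_ball (R : ℝ) :
    IntegrableOn (fun y : R4 => Real.log ‖y‖) (Metric.ball 0 R) := by
  rw [integrableOn_fun_norm_addHaar (volume : Measure R4) (f := Real.log)]
  simp only [finrank_euclideanSpace, Fintype.card_fin, smul_eq_mul]
  have hc : Continuous fun y : ℝ => y ^ (4 - 1) * Real.log y := by
    have : (fun y : ℝ => y ^ (4 - 1) * Real.log y) = fun y => y ^ 2 * (y * Real.log y) := by
      ext y; ring
    rw [this]
    exact (continuous_pow 2).mul Real.continuous_mul_log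
  exact (hc.integrableOn_Icc (a := 0) (b := R)).mono_set Set.Ioo_subset_Icc_self

lemma abs_log_div_le (a b : ℝ) : |Real.log (a / b)| ≤ |Real.log a| + |Real.log b| := by
  rcases eq_or_ne a 0 with rfl | ha
  · simp
  rcases eq_or_ne b 0 with rfl | hb
  · simp
  rw [Real.log_div ha hb]
  exact abs_sub _ _

/-- On a large ball F is bounded and both logarithms are integrable. Outside it |y|/2 ≤ |x - y| ≤
2|y|, so the kernel is at most log 2 in absolute value. -/
lemma integrable_log_kernel {F : ℝ → ℝ} (hF : Measurable F)
    (hbd : ∀ R : ℝ, ∃ C : ℝ, ∀ t, 0 ≤ t → t ≤ R → |F t| ≤ C)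
    (hint : Integrable fun y : R4 => F (‖y‖ ^ 2)) (x : R4) :
    Integrable fun y : R4 => Real.log (‖y‖ / ‖x - y‖) * F (‖y‖ ^ 2) := by
  set R : ℝ := 2 * ‖x‖ + 1 with hR
  have hRpos : 0 < R := by positivity
  have hmeas : Measurable fun y : R4 => Real.log (‖y‖ / ‖x - y‖) * F (‖y‖ ^ 2) := by
    have : Measurable fun y : R4 => F (‖y‖ ^ 2) := hF.comp (by fun_prop)
    fun_prop
  rw [← integrableOn_univ, ← Set.union_compl_self (Metric.ball (0 : R4) R)]
  refine IntegrableOn.union ?_ ?_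
  · obtain ⟨C, hC⟩ := hbd (R ^ 2)
    have h1 := integrableOn_log_norm_ball R
    have h2 : IntegrableOn (fun y : R4 => Real.log ‖x - y‖) (Metric.ball 0 R) := by
      have h3 := ((integrable_indicator_iff measurableSet_ball).2
        (integrableOn_log_norm_ball (R + ‖x‖))).comp_sub_left x
      refine (h3.integrableOn (s := Metric.ball 0 R)).congr_fun (fun y hy => ?_)
        measurableSet_ball
      have : x - y ∈ Metric.ball (0 : R4) (R + ‖x‖) := by
        rw [mem_ball_zero_iff] at hy ⊢
        linarith [norm_sub_le x y]
      simp [Set.indicator_of_mem this]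
    refine Integrable.mono' ((h1.abs.add h2.abs).mul_const C) hmeas.aestronglyMeasurable ?_
    filter_upwards [ae_restrict_mem measurableSet_ball] with y hy
    rw [mem_ball_zero_iff] at hy
    rw [Real.norm_eq_abs, abs_mul]
    exact mul_le_mul (abs_log_div_le _ _)
      (hC _ (by positivity) (pow_le_pow_left₀ (norm_nonneg y) hy.le 2)) (abs_nonneg _)
      (add_nonneg (abs_nonneg _) (abs_nonneg _))
  · refine Integrable.mono' (hint.abs.const_mul (Real.log 2)).integrableOn
      hmeas.aestronglyMeasurable ?_
    filter_upwards [ae_restrict_mem measurableSet_ball.compl] with y hy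
    rw [Set.mem_compl_iff, mem_ball_zero_iff, not_lt] at hy
    rw [Real.norm_eq_abs, abs_mul]
    refine mul_le_mul_of_nonneg_right ?_ (abs_nonneg _)
    have hy0 : 0 < ‖y‖ := by linarith
    have h1 : ‖y‖ / 2 ≤ ‖x - y‖ := by
      have := norm_sub_norm_le y x
      rw [norm_sub_rev] at this
      linarith
    have h2 : ‖x - y‖ ≤ 2 * ‖y‖ := by linarith [norm_sub_le x y]
    have hxy : 0 < ‖x - y‖ := by linarith
    rw [abs_le]
    constructor
    · rw [← Real.log_inv]
      refine Real.log_le_log (by norm_num) ?_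
      rw [le_div_iff₀ hxy]; linarith
    · refine Real.log_le_log (by positivity) ?_
      rw [div_le_iff₀ hxy]; linarith

/-! ### The shooting map and its kernel -/

/-- The Green kernel of `Δ²` for radial initial value problems, in the variable `|x|²`. -/
noncomputable def radialGreenKernel (τ t : ℝ) : ℝ := τ / 32 - radialLogKernel τ t / 8

/-- The density `(1 + |x|^p) e^{4u}` of a radial function, in the variable `t = |x|²`. -/
noncomputable def radialDensity (p : ℝ) (V : ℝ → ℝ) (t : ℝ) : ℝ :=
  (1 + t ^ (p / 2)) * Real.exp (4 * V t)

/-- The integral operator whose fixed points are the radial solutions with `u 0 = ρ` and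
`Δ u 0 = a`. -/
noncomputable def shootingMap (p ρ a : ℝ) (V : ℝ → ℝ) (τ : ℝ) : ℝ :=
  ρ + a * τ / 8 + ∫ t in Set.Ioi (0 : ℝ), radialGreenKernel τ t * radialDensity p V t

lemma measurable_radialGreenKernel : Measurable fun q : ℝ × ℝ => radialGreenKernel q.1 q.2 := by
  unfold radialGreenKernel
  have := measurable_radialLogKernel
  fun_prop

lemma radialLogKernel_nonneg {τ t : ℝ} (hτ : 0 ≤ τ) (ht : 0 < t) : 0 ≤ radialLogKernel τ t := by
  unfold radialLogKernel
  split_ifs with h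
  · have : 0 ≤ Real.log (τ / t) := Real.log_nonneg ((one_le_div ht).2 h.le)
    positivity
  · positivity

/-- This is x ≤ sinh x at x = log y. Taken at y = τ/t, it produces a term that exactly cancels
t²/(4τ) in the bound K ≤ τ/4. -/
lemma two_mul_log_le_sub_inv {y : ℝ} (hy : 1 ≤ y) : 2 * Real.log y ≤ y - y⁻¹ := by
  have h := Real.self_le_sinh_iff.2 (Real.log_nonneg hy)
  rw [Real.sinh_log (by linarith)] at h
  linarith

lemma radialLogKernel_le {τ t : ℝ} (ht : 0 < t) : radialLogKernel τ t ≤ τ / 4 := by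
  unfold radialLogKernel
  split_ifs with h
  · have hτ : 0 < τ := ht.trans h
    have h1 := two_mul_log_le_sub_inv ((one_le_div ht).2 h.le)
    have h2 : t / 2 * Real.log (τ / t) ≤ t / 4 * (τ / t - (τ / t)⁻¹) := by nlinarith
    refine (add_le_add_left h2 _).trans (le_of_eq ?_)
    field_simp
    ring
  · exact le_rfl

lemma radialGreenKernel_nonneg {τ t : ℝ} (ht : 0 < t) : 0 ≤ radialGreenKernel τ t := by
  unfold radialGreenKernel
  linarith [radialLogKernel_le (τ := τ) ht]

lemma radialGreenKernel_le {τ t : ℝ} (hτ : 0 ≤ τ) (ht : 0 < t) :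
    radialGreenKernel τ t ≤ τ / 32 := by
  unfold radialGreenKernel
  linarith [radialLogKernel_nonneg hτ ht]

/-- The Volterra property: the shooting map at τ sees only the values on (0, τ), which makes a
Gronwall argument possible. -/
lemma radialGreenKernel_of_le {τ t : ℝ} (h : τ ≤ t) : radialGreenKernel τ t = 0 := by
  unfold radialGreenKernel radialLogKernel
  rw [if_neg (not_lt.2 h)]; ring

lemma radialDensity_nonneg (p : ℝ) (V : ℝ → ℝ) {t : ℝ} (ht : 0 ≤ t) : 0 ≤ radialDensity p V t := by
  unfold radialDensity
  have := Real.rpow_nonneg ht (p / 2)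
  positivity

lemma measurable_radialDensity (p : ℝ) {V : ℝ → ℝ} (hV : Measurable V) :
    Measurable (radialDensity p V) := by
  unfold radialDensity
  fun_prop

lemma radialDensity_mono (p : ℝ) {V W : ℝ → ℝ} {t : ℝ} (ht : 0 ≤ t) (h : V t ≤ W t) :
    radialDensity p V t ≤ radialDensity p W t := by
  unfold radialDensity
  have := Real.rpow_nonneg ht (p / 2)
  gcongr

lemma measurable_shootingMap (p ρ a : ℝ) {V : ℝ → ℝ} (hV : Measurable V) :
    Measurable (shootingMap p ρ a V) := by
  unfold shootingMap
  have h : Measurable fun q : ℝ × ℝ => radialGreenKernel q.1 q.2 * radialDensity p V q.2 :=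
    measurable_radialGreenKernel.mul ((measurable_radialDensity p hV).comp measurable_snd)
  have := (h.stronglyMeasurable.integral_prod_right'
    (ν := volume.restrict (Set.Ioi (0 : ℝ)))).measurable
  fun_prop

lemma integrableOn_radialGreenKernel_mul {τ : ℝ} (hτ : 0 ≤ τ) {F : ℝ → ℝ}
    (hF : IntegrableOn F (Set.Ioi 0)) :
    IntegrableOn (fun t => radialGreenKernel τ t * F t) (Set.Ioi 0) := by
  refine Integrable.bdd_mul hF (c := τ / 32)
    (measurable_radialGreenKernel.comp (measurable_prodMk_left (x := τ))).aestronglyMeasurable ?_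
  filter_upwards [ae_restrict_mem measurableSet_Ioi] with t ht
  rw [Real.norm_eq_abs, abs_of_nonneg (radialGreenKernel_nonneg ht)]
  exact radialGreenKernel_le hτ ht

/-- `V` lies above its image under the shooting map, and its total mass keeps `Δ u ≤ 0`. -/
structure IsShootingSuper (p ρ a : ℝ) (V : ℝ → ℝ) : Prop where
  measurable : Measurable V
  integrable : IntegrableOn (radialDensity p V) (Set.Ioi 0)
  le : ∀ τ, 0 ≤ τ → shootingMap p ρ a V τ ≤ V τ
  mass_le : a + 1 / 4 * (∫ t in Set.Ioi (0 : ℝ), radialDensity p V t) ≤ 0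

/-- `V` is a fixed point of the shooting map whose total mass keeps `Δ u ≤ 0`. -/
structure IsShootingSol (p ρ a : ℝ) (V : ℝ → ℝ) : Prop where
  measurable : Measurable V
  integrable : IntegrableOn (radialDensity p V) (Set.Ioi 0)
  eq : ∀ τ, 0 ≤ τ → V τ = shootingMap p ρ a V τ
  mass_le : a + 1 / 4 * (∫ t in Set.Ioi (0 : ℝ), radialDensity p V t) ≤ 0

lemma shootingMap_mono {p ρ a : ℝ} {V W : ℝ → ℝ} (hV : IntegrableOn (radialDensity p V) (Set.Ioi 0))
    (hW : IntegrableOn (radialDensity p W) (Set.Ioi 0)) (h : ∀ t, 0 ≤ t → V t ≤ W t) {τ : ℝ}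
    (hτ : 0 ≤ τ) : shootingMap p ρ a V τ ≤ shootingMap p ρ a W τ := by
  unfold shootingMap
  refine add_le_add_right ?_ _
  refine setIntegral_mono_on (integrableOn_radialGreenKernel_mul hτ hV)
    (integrableOn_radialGreenKernel_mul hτ hW) measurableSet_Ioi fun t ht => ?_
  have ht : 0 < t := ht
  exact mul_le_mul_of_nonneg_left (radialDensity_mono p ht.le (h t ht.le))
    (radialGreenKernel_nonneg ht)

/-- Bounding the kernel by τ/32 gathers everything into one linear term, whose slope is nonpositive
under `mass_le`. Hence fixed points stay below ρ. -/
lemma shootingMap_le {p ρ a : ℝ} {V : ℝ → ℝ} (hV : IntegrableOn (radialDensity p V) (Set.Ioi 0))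
    {τ : ℝ} (hτ : 0 ≤ τ) : shootingMap p ρ a V τ ≤
      ρ + τ / 8 * (a + 1 / 4 * (∫ t in Set.Ioi (0 : ℝ), radialDensity p V t)) := by
  have h : ∫ t in Set.Ioi (0 : ℝ), radialGreenKernel τ t * radialDensity p V t ≤
      ∫ t in Set.Ioi (0 : ℝ), τ / 32 * radialDensity p V t := by
    refine setIntegral_mono_on (integrableOn_radialGreenKernel_mul hτ hV) (hV.const_mul _)
      measurableSet_Ioi fun t ht => ?_
    exact mul_le_mul_of_nonneg_right (radialGreenKernel_le hτ ht)
      (radialDensity_nonneg p V (le_of_lt ht))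
  rw [integral_const_mul] at h
  unfold shootingMap
  linarith

lemma le_shootingMap (p ρ a : ℝ) (V : ℝ → ℝ) (τ : ℝ) : ρ + a * τ / 8 ≤ shootingMap p ρ a V τ := by
  have : 0 ≤ ∫ t in Set.Ioi (0 : ℝ), radialGreenKernel τ t * radialDensity p V t :=
    setIntegral_nonneg measurableSet_Ioi fun t ht =>
      mul_nonneg (radialGreenKernel_nonneg ht) (radialDensity_nonneg p V (le_of_lt ht))
  unfold shootingMap
  linarith

lemma IsShootingSol.le {p ρ a : ℝ} {V : ℝ → ℝ} (h : IsShootingSol p ρ a V) {τ : ℝ} (hτ : 0 ≤ τ) :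
    V τ ≤ ρ := by
  rw [h.eq τ hτ]
  have := shootingMap_le (ρ := ρ) (a := a) h.integrable hτ
  nlinarith [h.mass_le]

/-- Passage to the limit in the shooting map under a dominating density. -/
lemma tendsto_shootingMap {p ρ : ℝ} {a : ℕ → ℝ} {a₀ : ℝ} {V : ℕ → ℝ → ℝ} {W G : ℝ → ℝ}
    (ha : Filter.Tendsto a Filter.atTop (nhds a₀))
    (hV : ∀ n, Measurable (V n)) (hG : IntegrableOn G (Set.Ioi 0))
    (hbd : ∀ n t, 0 ≤ t → radialDensity p (V n) t ≤ G t)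
    (hlim : ∀ t, 0 ≤ t → Filter.Tendsto (fun n => V n t) Filter.atTop (nhds (W t))) :
    Filter.Tendsto (fun n => ∫ t in Set.Ioi (0 : ℝ), radialDensity p (V n) t) Filter.atTop
      (nhds (∫ t in Set.Ioi (0 : ℝ), radialDensity p W t)) ∧
    ∀ τ, 0 ≤ τ → Filter.Tendsto (fun n => shootingMap p ρ (a n) (V n) τ) Filter.atTop
      (nhds (shootingMap p ρ a₀ W τ)) := by
  have hlimF : ∀ t, 0 ≤ t → Filter.Tendsto (fun n => radialDensity p (V n) t) Filter.atTop
      (nhds (radialDensity p W t)) := fun t ht =>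
    ((Real.continuous_exp.tendsto _).comp ((hlim t ht).const_mul 4)).const_mul _
  constructor
  · refine tendsto_integral_of_dominated_convergence G
      (fun n => (measurable_radialDensity p (hV n)).aestronglyMeasurable) hG (fun n => ?_) ?_
    · filter_upwards [ae_restrict_mem measurableSet_Ioi] with t ht
      rw [Real.norm_eq_abs, abs_of_nonneg (radialDensity_nonneg p _ (le_of_lt ht))]
      exact hbd n t (le_of_lt ht)
    · filter_upwards [ae_restrict_mem measurableSet_Ioi] with t ht using hlimF t (le_of_lt ht)
  · intro τ hτ
    unfold shootingMap
    refine (((ha.mul_const τ).div_const 8).const_add ρ).add ?_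
    refine tendsto_integral_of_dominated_convergence (fun t => τ / 32 * G t)
      (fun n => ((measurable_radialGreenKernel.comp (measurable_prodMk_left (x := τ))).mul
        (measurable_radialDensity p (hV n))).aestronglyMeasurable) (hG.const_mul _) (fun n => ?_) ?_
    · filter_upwards [ae_restrict_mem measurableSet_Ioi] with t ht
      have ht : 0 < t := ht
      rw [Real.norm_eq_abs, abs_of_nonneg (mul_nonneg (radialGreenKernel_nonneg ht)
        (radialDensity_nonneg p _ ht.le))]
      exact mul_le_mul (radialGreenKernel_le hτ ht) (hbd n t ht.le)
        (radialDensity_nonneg p _ ht.le) (by positivity)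
    · filter_upwards [ae_restrict_mem measurableSet_Ioi] with t ht using
        (hlimF t (le_of_lt ht)).const_mul _

lemma integrableOn_radialDensity_of_le {p : ℝ} {V : ℝ → ℝ} {G : ℝ → ℝ} (hV : Measurable V)
    (hG : IntegrableOn G (Set.Ioi 0)) (h : ∀ t, 0 < t → radialDensity p V t ≤ G t) :
    IntegrableOn (radialDensity p V) (Set.Ioi 0) := by
  refine Integrable.mono' hG (measurable_radialDensity p hV).aestronglyMeasurable ?_
  filter_upwards [ae_restrict_mem measurableSet_Ioi] with t ht
  rw [Real.norm_eq_abs, abs_of_nonneg (radialDensity_nonneg p _ (le_of_lt ht))]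
  exact h t ht

/-! ### Monotone iteration and comparison -/

/-- Iterating the monotone map from V gives a decreasing sequence bounded below by ρ + aτ/8, and the
density of V dominates all the others in the limit. -/
lemma IsShootingSuper.exists_sol {p ρ a : ℝ} {V : ℝ → ℝ} (h : IsShootingSuper p ρ a V) :
    ∃ U, IsShootingSol p ρ a U := by
  set S : ℕ → ℝ → ℝ := fun n => (shootingMap p ρ a)^[n] V with hS
  have hsucc : ∀ n, S (n + 1) = shootingMap p ρ a (S n) := fun n =>
    Function.iterate_succ_apply' _ _ _
  have hmeas : ∀ n, Measurable (S n) := by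
    intro n
    induction n with
    | zero => exact h.measurable
    | succ n ih => rw [hsucc]; exact measurable_shootingMap p ρ a ih
  have hint_of : ∀ n, (∀ t, 0 ≤ t → S n t ≤ V t) →
      IntegrableOn (radialDensity p (S n)) (Set.Ioi 0) := fun n hn =>
    integrableOn_radialDensity_of_le (hmeas n) h.integrable fun t ht =>
      radialDensity_mono p ht.le (hn t ht.le)
  have hanti : ∀ n, (∀ t, 0 ≤ t → S n t ≤ V t) ∧ ∀ t, 0 ≤ t → S (n + 1) t ≤ S n t := by
    intro n
    induction n with
    | zero => exact ⟨fun t _ => le_rfl, fun t ht => by rw [hsucc]; exact h.le t ht⟩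
    | succ n ih =>
      have h1 : ∀ t, 0 ≤ t → S (n + 1) t ≤ V t := fun t ht => (ih.2 t ht).trans (ih.1 t ht)
      refine ⟨h1, fun t ht => ?_⟩
      rw [hsucc (n + 1)]
      conv_rhs => rw [hsucc n]
      exact shootingMap_mono (hint_of _ h1) (hint_of _ ih.1) ih.2 ht
  have hlow : ∀ n t, 0 ≤ t → ρ + a * t / 8 ≤ S n t := by
    intro n t ht
    cases n with
    | zero => exact (le_shootingMap p ρ a V t).trans (h.le t ht)
    | succ n => rw [hsucc]; exact le_shootingMap p ρ a _ t
  have hlim : ∀ t, 0 ≤ t → Filter.Tendsto (fun n => S n t) Filter.atTop (nhds (⨅ n, S n t)) := by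
    intro t ht
    refine tendsto_atTop_ciInf (antitone_nat_of_succ_le fun n => (hanti n).2 t ht) ?_
    exact ⟨ρ + a * t / 8, by rintro _ ⟨n, rfl⟩; exact hlow n t ht⟩
  -- The iterates are known to be ordered and bounded only for t ≥ 0, while U has to be measurable
  -- on all of ℝ; hence `max t 0`.
  set U : ℝ → ℝ := fun t => ⨅ n, S n (max t 0) with hU
  have hUlim : ∀ t, 0 ≤ t → Filter.Tendsto (fun n => S n t) Filter.atTop (nhds (U t)) := by
    intro t ht
    simpa [hU, max_eq_left ht] using hlim t ht
  have hUm : Measurable U := by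
    refine measurable_of_tendsto_metrizable (f := fun n t => S n (max t 0))
      (fun n => (hmeas n).comp (by fun_prop)) ?_
    rw [tendsto_pi_nhds]
    exact fun t => hlim _ (le_max_right _ _)
  have hUle : ∀ t, 0 ≤ t → U t ≤ V t := fun t ht =>
    le_of_tendsto (hUlim t ht) (Filter.Eventually.of_forall fun n => (hanti n).1 t ht)
  have hconv := tendsto_shootingMap (ρ := ρ) (a := fun _ => a) tendsto_const_nhds hmeas h.integrable
    (fun n t ht => radialDensity_mono p ht ((hanti n).1 t ht)) hUlim
  have hUint : IntegrableOn (radialDensity p U) (Set.Ioi 0) :=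
    integrableOn_radialDensity_of_le hUm h.integrable fun t ht =>
      radialDensity_mono p ht.le (hUle t ht.le)
  refine ⟨U, hUm, hUint, fun τ hτ => ?_, ?_⟩
  · refine tendsto_nhds_unique ((hUlim τ hτ).comp (Filter.tendsto_add_atTop_nat 1)) ?_
    refine (hconv.2 τ hτ).congr fun n => ?_
    simp only [Function.comp, hsucc]
  · have : ∫ t in Set.Ioi (0 : ℝ), radialDensity p U t ≤
        ∫ t in Set.Ioi (0 : ℝ), radialDensity p V t :=
      setIntegral_mono_on hUint h.integrable measurableSet_Ioi fun t ht =>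
        radialDensity_mono p (le_of_lt ht) (hUle t (le_of_lt ht))
    linarith [h.mass_le]

/-- Gronwall without continuity: iterating the inequality gives d τ ≤ M (Cτ)^n / n!, which tends to
0. -/
lemma le_zero_of_le_mul_integral {d : ℝ → ℝ} {T C M : ℝ} (hC : 0 ≤ C) (hd : Measurable d)
    (hd0 : ∀ t, 0 ≤ d t) (hdM : ∀ t, 0 ≤ t → t ≤ T → d t ≤ M)
    (h : ∀ τ, 0 ≤ τ → τ ≤ T → d τ ≤ C * ∫ t in (0 : ℝ)..τ, d t) :
    ∀ τ, 0 ≤ τ → τ ≤ T → d τ ≤ 0 := by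
  have hint : ∀ τ, 0 ≤ τ → τ ≤ T → IntervalIntegrable d volume 0 τ := by
    intro τ hτ hτT
    rw [intervalIntegrable_iff_integrableOn_Ioc_of_le hτ]
    refine Measure.integrableOn_of_bounded (M := M) (by simp) hd.aestronglyMeasurable ?_
    filter_upwards [ae_restrict_mem measurableSet_Ioc] with t ht
    rw [Real.norm_eq_abs, abs_of_nonneg (hd0 t)]
    exact hdM t ht.1.le (ht.2.trans hτT)
  have key : ∀ n : ℕ, ∀ τ, 0 ≤ τ → τ ≤ T → d τ ≤ M * ((C * τ) ^ n / n.factorial) := by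
    intro n
    induction n with
    | zero => intro τ h0 h1; simpa using hdM τ h0 h1
    | succ n ih =>
      intro τ h0 h1
      have h2 : ∫ t in (0 : ℝ)..τ, d t ≤ ∫ t in (0 : ℝ)..τ, M * ((C * t) ^ n / n.factorial) :=
        intervalIntegral.integral_mono_on h0 (hint τ h0 h1)
          (Continuous.intervalIntegrable (by fun_prop) _ _)
          fun t ht => ih t ht.1 (ht.2.trans h1)
      have h3 : ∫ t in (0 : ℝ)..τ, M * ((C * t) ^ n / n.factorial) =
          M * C ^ n / n.factorial * (τ ^ (n + 1) / (n + 1)) := by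
        have : ∀ t : ℝ, M * ((C * t) ^ n / n.factorial) = M * C ^ n / n.factorial * t ^ n := by
          intro t; rw [mul_pow]; ring
        simp_rw [this]
        rw [intervalIntegral.integral_const_mul, integral_pow]
        simp
      refine (h τ h0 h1).trans ((mul_le_mul_of_nonneg_left h2 hC).trans (le_of_eq ?_))
      rw [h3, Nat.factorial_succ]
      push_cast
      field_simp
      ring
  intro τ h0 h1
  refine ge_of_tendsto' (x := Filter.atTop) ?_ (fun n => key n τ h0 h1)
  simpa using (FloorSemiring.tendsto_pow_div_factorial_atTop (C * τ)).const_mul M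

/-- Comparison principle for the radial initial value problem. -/
lemma IsShootingSol.mono {p ρ a b : ℝ} (hp : 0 < p) {U V : ℝ → ℝ} (hU : IsShootingSol p ρ a U)
    (hV : IsShootingSol p ρ b V) (hab : a ≤ b) : ∀ τ, 0 ≤ τ → U τ ≤ V τ := by
  intro T hT
  set d : ℝ → ℝ := fun t => max (U t - V t) 0 with hd
  have hdm : Measurable d := (hU.measurable.sub hV.measurable).max measurable_const
  -- A one-sided Lipschitz constant for the density on [0, T], available because U ≤ ρ.
  set L : ℝ := (1 + T ^ (p / 2)) * (4 * Real.exp (4 * ρ)) with hL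
  have hT2 : 0 ≤ T ^ (p / 2) := Real.rpow_nonneg hT _
  have hL0 : 0 ≤ L := by positivity
  have hdM : ∀ t, 0 ≤ t → t ≤ T → d t ≤ |b| * T / 8 := by
    intro t h0 h1
    refine max_le ?_ (by positivity)
    have h2 := hU.le h0
    have h3 := le_shootingMap p ρ b V t
    rw [← hV.eq t h0] at h3
    have h4 : -(b * t) ≤ |b| * T := by
      calc -(b * t) ≤ |b| * t := by nlinarith [neg_abs_le b]
        _ ≤ |b| * T := by gcongr
    linarith
  have hpt : ∀ t, 0 < t → t ≤ T → radialDensity p U t - radialDensity p V t ≤ L * d t := by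
    intro t h0 h1
    have hk : t ^ (p / 2) ≤ T ^ (p / 2) := Real.rpow_le_rpow h0.le h1 (by positivity)
    have hk0 : 0 ≤ t ^ (p / 2) := Real.rpow_nonneg h0.le _
    rcases le_total (U t) (V t) with h | h
    · have h2 : 0 ≤ d t := le_max_right _ _
      have := radialDensity_mono p h0.le h
      nlinarith
    · have h2 : d t = U t - V t := max_eq_left (by linarith)
      have h3 : Real.exp (4 * U t) - Real.exp (4 * V t) ≤
          Real.exp (4 * ρ) * (4 * (U t - V t)) := by
        have h4 : Real.exp (4 * V t) = Real.exp (4 * U t) * Real.exp (-(4 * (U t - V t))) := by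
          rw [← Real.exp_add]; ring_nf
        have h5 := Real.add_one_le_exp (-(4 * (U t - V t)))
        have h6 : Real.exp (4 * U t) ≤ Real.exp (4 * ρ) :=
          Real.exp_le_exp.2 (by linarith [hU.le h0.le])
        have h7 := Real.exp_pos (4 * U t)
        nlinarith
      rw [h2]
      unfold radialDensity
      rw [← mul_sub, hL]
      have h8 : 0 ≤ Real.exp (4 * ρ) * (4 * (U t - V t)) :=
        mul_nonneg (Real.exp_pos _).le (by linarith)
      calc (1 + t ^ (p / 2)) * (Real.exp (4 * U t) - Real.exp (4 * V t))
          ≤ (1 + t ^ (p / 2)) * (Real.exp (4 * ρ) * (4 * (U t - V t))) := by gcongr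
        _ ≤ (1 + T ^ (p / 2)) * (Real.exp (4 * ρ) * (4 * (U t - V t))) := by gcongr
        _ = _ := by ring
  have hgron : ∀ τ, 0 ≤ τ → τ ≤ T → d τ ≤ T / 32 * L * ∫ t in (0 : ℝ)..τ, d t := by
    intro τ h0 h1
    have hI : 0 ≤ ∫ t in (0 : ℝ)..τ, d t :=
      intervalIntegral.integral_nonneg h0 fun t _ => le_max_right _ _
    refine max_le ?_ (by positivity)
    rw [hU.eq τ h0, hV.eq τ h0]
    have hdint : IntegrableOn d (Set.Ioc 0 τ) := by
      refine Measure.integrableOn_of_bounded (M := |b| * T / 8) (by simp)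
        hdm.aestronglyMeasurable ?_
      filter_upwards [ae_restrict_mem measurableSet_Ioc] with t ht
      rw [Real.norm_eq_abs, abs_of_nonneg (le_max_right _ _)]
      exact hdM t ht.1.le (ht.2.trans h1)
    have h2 : (∫ t in Set.Ioi (0 : ℝ), radialGreenKernel τ t * radialDensity p U t) -
        ∫ t in Set.Ioi (0 : ℝ), radialGreenKernel τ t * radialDensity p V t ≤
        ∫ t in Set.Ioi (0 : ℝ), (Set.Ioc 0 τ).indicator (fun t => T / 32 * L * d t) t := by
      rw [← integral_sub (integrableOn_radialGreenKernel_mul h0 hU.integrable)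
        (integrableOn_radialGreenKernel_mul h0 hV.integrable)]
      refine setIntegral_mono_on ((integrableOn_radialGreenKernel_mul h0 hU.integrable).sub
        (integrableOn_radialGreenKernel_mul h0 hV.integrable))
        (((integrable_indicator_iff measurableSet_Ioc).2 (hdint.const_mul _)).integrableOn)
        measurableSet_Ioi fun t ht => ?_
      have ht : 0 < t := ht
      rcases le_or_gt t τ with htτ | htτ
      · rw [Set.indicator_of_mem (show t ∈ Set.Ioc 0 τ from ⟨ht, htτ⟩), ← mul_sub]
        have h3 := hpt t ht (htτ.trans h1)
        have h4 := radialGreenKernel_nonneg (τ := τ) ht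
        have h5 : radialGreenKernel τ t ≤ T / 32 :=
          (radialGreenKernel_le h0 ht).trans (by linarith)
        have h6 : 0 ≤ L * d t := mul_nonneg hL0 (le_max_right _ _)
        nlinarith
      · rw [radialGreenKernel_of_le htτ.le, Set.indicator_of_notMem (fun h => by
          exact absurd h.2 (not_le.2 htτ))]
        simp
    rw [setIntegral_indicator measurableSet_Ioc,
      Set.inter_eq_right.2 Set.Ioc_subset_Ioi_self, integral_const_mul,
      ← intervalIntegral.integral_of_le h0] at h2
    unfold shootingMap
    have h3 : a * τ ≤ b * τ := by gcongr
    linarith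
  have := le_zero_of_le_mul_integral (d := d) (T := T) (by positivity) hdm
    (fun _ => le_max_right _ _) hdM hgron T hT le_rfl
  have h2 : U T - V T ≤ d T := le_max_left _ _
  linarith

/-! ### The maximal shooting parameter -/

lemma integrableOn_rpow_mul_exp_neg {s b : ℝ} (hs : -1 < s) (hb : 0 < b) :
    IntegrableOn (fun t : ℝ => t ^ s * Real.exp (-(b * t))) (Set.Ioi 0) := by
  simpa using integrableOn_rpow_mul_exp_neg_mul_rpow hs one_pos hb

lemma integrableOn_weight_mul_exp_neg {p b : ℝ} (hp : 0 < p) (hb : 0 < b) :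
    IntegrableOn (fun t : ℝ => (1 + t ^ (p / 2)) * Real.exp (-(b * t))) (Set.Ioi 0) := by
  refine IntegrableOn.congr_fun ((integrableOn_rpow_mul_exp_neg (s := 0) (by norm_num) hb).add
    (integrableOn_rpow_mul_exp_neg (s := p / 2) (by linarith) hb)) (fun t _ => ?_) measurableSet_Ioi
  simp [add_mul]

lemma integrableOn_mul_weight_mul_exp_neg {p b : ℝ} (hp : 0 < p) (hb : 0 < b) :
    IntegrableOn (fun t : ℝ => t * (1 + t ^ (p / 2)) * Real.exp (-(b * t))) (Set.Ioi 0) := by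
  refine IntegrableOn.congr_fun ((integrableOn_rpow_mul_exp_neg (s := 1) (by norm_num) hb).add
    (integrableOn_rpow_mul_exp_neg (s := 1 + p / 2) (by linarith) hb)) (fun t ht => ?_)
    measurableSet_Ioi
  simp only [Pi.add_apply, Real.rpow_add (show (0 : ℝ) < t from ht), Real.rpow_one]
  ring

lemma exists_shootingSol {p : ℝ} (hp : 0 < p) (ρ : ℝ) : ∃ a U, IsShootingSol p ρ a U := by
  have hint : IntegrableOn (radialDensity p fun t => ρ - t) (Set.Ioi 0) := by
    refine IntegrableOn.congr_fun ((integrableOn_weight_mul_exp_neg hp four_pos).const_mul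
      (Real.exp (4 * ρ))) (fun t _ => ?_) measurableSet_Ioi
    simp only [radialDensity, mul_sub, Real.exp_sub, Real.exp_neg]
    ring
  -- With this a, the slope in `shootingMap_le` is -8/8, so the image of ρ - t lies below itself.
  refine ⟨-8 - 1 / 4 * (∫ t in Set.Ioi (0 : ℝ), radialDensity p (fun t => ρ - t) t), ?_⟩
  refine IsShootingSuper.exists_sol (V := fun t => ρ - t) ⟨by fun_prop, hint, fun τ hτ => ?_, ?_⟩
  · refine (shootingMap_le hint hτ).trans (le_of_eq ?_)
    ring
  · linarith

/-- Along parameters increasing to the supremum the solutions increase and stay below ρ. Their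
integrals ∫F are at most -4 a₀, a₀ being the first parameter, so Fatou makes the limit density
integrable; it then serves as the dominating function. -/
lemma exists_shootingSol_sSup {p : ℝ} (hp : 0 < p) (ρ : ℝ) :
    ∃ a U, IsShootingSol p ρ a U ∧ ∀ b V, IsShootingSol p ρ b V → b ≤ a := by
  set A : Set ℝ := {a | ∃ U, IsShootingSol p ρ a U} with hA
  have hne : A.Nonempty := exists_shootingSol hp ρ
  have hbdd : BddAbove A := by
    refine ⟨0, ?_⟩
    rintro a ⟨U, hU⟩
    have : 0 ≤ ∫ t in Set.Ioi (0 : ℝ), radialDensity p U t :=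
      setIntegral_nonneg measurableSet_Ioi fun t ht => radialDensity_nonneg p U (le_of_lt ht)
    linarith [hU.mass_le]
  obtain ⟨a, ha_mono, ha_lim, ha_mem⟩ := exists_seq_tendsto_sSup hne hbdd
  choose U hU using ha_mem
  have hmono : ∀ t, 0 ≤ t → Monotone fun n => U n t := fun t ht m n hmn =>
    (hU m).mono hp (hU n) (ha_mono hmn) t ht
  have hlim : ∀ t, 0 ≤ t → Filter.Tendsto (fun n => U n t) Filter.atTop (nhds (⨆ n, U n t)) :=
    fun t ht => tendsto_atTop_ciSup (hmono t ht) ⟨ρ, by rintro _ ⟨n, rfl⟩; exact (hU n).le ht⟩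
  set V : ℝ → ℝ := fun t => ⨆ n, U n (max t 0) with hV
  have hVlim : ∀ t, 0 ≤ t → Filter.Tendsto (fun n => U n t) Filter.atTop (nhds (V t)) := by
    intro t ht
    simpa [hV, max_eq_left ht] using hlim t ht
  have hVm : Measurable V := by
    refine measurable_of_tendsto_metrizable (f := fun n t => U n (max t 0))
      (fun n => (hU n).measurable.comp (by fun_prop)) ?_
    rw [tendsto_pi_nhds]
    exact fun t => hlim _ (le_max_right _ _)
  have hle : ∀ n t, 0 ≤ t → radialDensity p (U n) t ≤ radialDensity p V t := fun n t ht =>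
    radialDensity_mono p ht ((hmono t ht).ge_of_tendsto (hVlim t ht) n)
  have hVint : IntegrableOn (radialDensity p V) (Set.Ioi 0) := by
    refine integrable_of_tendsto (G := fun n => radialDensity p (U n)) ?_
      (fun n => (measurable_radialDensity p (hU n).measurable).aestronglyMeasurable) ?_
    · filter_upwards [ae_restrict_mem measurableSet_Ioi] with t ht
      exact ((Real.continuous_exp.tendsto _).comp
        ((hVlim t (le_of_lt ht)).const_mul 4)).const_mul _
    · refine ne_top_of_le_ne_top (b := ENNReal.ofReal (-4 * a 0)) ENNReal.ofReal_ne_top ?_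
      refine Filter.liminf_le_of_frequently_le' (Filter.Eventually.frequently
        (Filter.Eventually.of_forall fun n => ?_))
      rw [← ofReal_integral_norm_eq_lintegral_enorm (hU n).integrable]
      refine ENNReal.ofReal_le_ofReal ?_
      have : ∫ t in Set.Ioi (0 : ℝ), ‖radialDensity p (U n) t‖ =
          ∫ t in Set.Ioi (0 : ℝ), radialDensity p (U n) t :=
        setIntegral_congr_fun measurableSet_Ioi fun t ht => by
          simp only [Real.norm_eq_abs]
          rw [abs_of_nonneg (radialDensity_nonneg p _ (le_of_lt ht))]
      rw [this]
      linarith [(hU n).mass_le, ha_mono (Nat.zero_le n)]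
  have hconv := tendsto_shootingMap (ρ := ρ) ha_lim (fun n => (hU n).measurable) hVint hle hVlim
  refine ⟨sSup A, V, ⟨hVm, hVint, fun τ hτ => ?_, ?_⟩, fun b W hW => le_csSup hbdd ⟨W, hW⟩⟩
  · refine tendsto_nhds_unique (hVlim τ hτ) ((hconv.2 τ hτ).congr fun n => ?_)
    exact ((hU n).eq τ hτ).symm
  · exact le_of_tendsto (ha_lim.add (hconv.1.const_mul (1 / 4)))
      (Filter.Eventually.of_forall fun n => (hU n).mass_le)

/-- A strict inequality gives U ≤ ρ - δτ/8, hence an exponentially decaying density. The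
supersolution at parameter a + ε is U + ε t E(t), with E bounded. -/
lemma IsShootingSol.exists_super_of_mass_lt {p ρ a : ℝ} (hp : 0 < p) {U : ℝ → ℝ}
    (hU : IsShootingSol p ρ a U)
    (hlt : a + 1 / 4 * (∫ t in Set.Ioi (0 : ℝ), radialDensity p U t) < 0) :
    ∃ b V, a < b ∧ IsShootingSuper p ρ b V := by
  obtain ⟨δ, hδ, hδ0⟩ : ∃ δ, a + 1 / 4 * (∫ t in Set.Ioi (0 : ℝ), radialDensity p U t) = -δ ∧
      0 < δ := ⟨_, (neg_neg _).symm, by linarith⟩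
  have hUle : ∀ t, 0 ≤ t → U t ≤ ρ - δ * t / 8 := by
    intro t ht
    rw [hU.eq t ht]
    refine (shootingMap_le hU.integrable ht).trans (le_of_eq ?_)
    rw [hδ]; ring
  -- Put x = 4εtE. The density grows by at most F x eˣ, where F ≤ (1 + t^(p/2)) e^{4ρ - δt/2}. Half
  -- of the decay is spent on eˣ ≤ e^{δt/4}, and what remains is 32 ε h E.
  set h : ℝ → ℝ := fun t =>
    1 / 8 * Real.exp (4 * ρ) * (t * (1 + t ^ (p / 2)) * Real.exp (-(δ / 4 * t))) with hh
  have hhint : IntegrableOn h (Set.Ioi 0) :=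
    (integrableOn_mul_weight_mul_exp_neg hp (by positivity)).const_mul _
  have hhc : Continuous h := by
    have : Continuous fun t : ℝ => t ^ (p / 2) := Real.continuous_rpow_const (by positivity)
    fun_prop
  have hh0 : ∀ t, 0 ≤ t → 0 ≤ h t := by
    intro t ht
    have := Real.rpow_nonneg ht (p / 2)
    positivity
  set H : ℝ → ℝ := fun τ => ∫ t in (0 : ℝ)..τ, h t with hH
  have hHd : ∀ τ, HasDerivAt H (h τ) τ := fun τ =>
    intervalIntegral.integral_hasDerivAt_right (hhc.intervalIntegrable _ _)
      (hhc.stronglyMeasurableAtFilter _ _) hhc.continuousAt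
  set I : ℝ := ∫ t in Set.Ioi (0 : ℝ), h t with hI
  have hI0 : 0 ≤ I := setIntegral_nonneg measurableSet_Ioi fun t ht => hh0 t (le_of_lt ht)
  have hHle : ∀ τ, 0 ≤ τ → H τ ≤ I := by
    intro τ hτ
    rw [hH, hI]
    simp only
    rw [intervalIntegral.integral_of_le hτ]
    refine setIntegral_mono_set hhint ?_ (Filter.Eventually.of_forall Set.Ioc_subset_Ioi_self)
    filter_upwards [ae_restrict_mem measurableSet_Ioi] with t ht using hh0 t (le_of_lt ht)
  -- E solves E' = hE with E(0) = 1/8, so that ετ/8 + ετ ∫₀^τ hE = ετE(τ): the increase of the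
  -- shooting map is bounded by exactly what is added to U.
  set E : ℝ → ℝ := fun τ => Real.exp (H τ) / 8 with hE
  have hEd : ∀ τ, HasDerivAt E (h τ * E τ) τ := by
    intro τ
    refine ((hHd τ).exp.div_const 8).congr_deriv ?_
    simp only [hE]; ring
  have hEc : Continuous E := continuous_iff_continuousAt.2 fun τ => (hEd τ).continuousAt
  have hEpos : ∀ τ, 0 < E τ := fun τ => by positivity
  set B : ℝ := Real.exp I / 8 with hB
  have hBpos : 0 < B := by positivity
  have hEB : ∀ τ, 0 ≤ τ → E τ ≤ B := by
    intro τ hτ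
    have := hHle τ hτ
    simp only [hE, hB]
    gcongr
  have hEint : ∀ τ, ∫ t in (0 : ℝ)..τ, h t * E t = E τ - 1 / 8 := by
    intro τ
    rw [intervalIntegral.integral_eq_sub_of_hasDerivAt (fun t _ => hEd t)
      ((hhc.mul hEc).intervalIntegrable _ _)]
    simp [hE, hH]
  -- The first bound gives x ≤ δt/4; the second preserves the mass condition at a + ε.
  obtain ⟨ε, hε0, hε1, hε2⟩ : ∃ ε, 0 < ε ∧ 4 * ε * B ≤ δ / 4 ∧ ε * (1 + 8 * B * I) ≤ δ := by
    have h1 : 0 < 1 + 8 * B * I := by positivity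
    refine ⟨min (δ / (16 * B)) (δ / (1 + 8 * B * I)), by positivity, ?_, ?_⟩
    · have := min_le_left (δ / (16 * B)) (δ / (1 + 8 * B * I))
      calc _ ≤ 4 * (δ / (16 * B)) * B := by gcongr
        _ = δ / 4 := by field_simp; ring
    · have := min_le_right (δ / (16 * B)) (δ / (1 + 8 * B * I))
      calc _ ≤ (δ / (1 + 8 * B * I)) * (1 + 8 * B * I) := by gcongr
        _ = δ := by field_simp
  set V : ℝ → ℝ := fun t => U t + ε * (t * E t) with hV
  have hVm : Measurable V := hU.measurable.add
    (measurable_const.mul (measurable_id.mul hEc.measurable))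
  have hpt : ∀ t, 0 < t →
      radialDensity p V t ≤ radialDensity p U t + 32 * ε * (h t * E t) := by
    intro t ht
    set x : ℝ := 4 * ε * (t * E t) with hx
    have hx0 : 0 ≤ x := by have := hEpos t; positivity
    have hx1 : x ≤ δ / 4 * t := by
      calc x = 4 * ε * E t * t := by rw [hx]; ring
        _ ≤ 4 * ε * B * t := by have := hEB t ht.le; gcongr
        _ ≤ δ / 4 * t := by gcongr
    have h1 : Real.exp x - 1 ≤ x * Real.exp x := by
      have h2 := Real.add_one_le_exp (-x)
      rw [Real.exp_neg] at h2
      have h3 := Real.exp_pos x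
      have h4 : (-x + 1) * Real.exp x ≤ 1 := by
        calc (-x + 1) * Real.exp x ≤ (Real.exp x)⁻¹ * Real.exp x := by gcongr
          _ = 1 := inv_mul_cancel₀ h3.ne'
      linarith
    have h5 : radialDensity p V t = radialDensity p U t * Real.exp x := by
      simp only [radialDensity, hV, hx]
      rw [mul_assoc, ← Real.exp_add]
      ring_nf
    have hk0 : 0 ≤ t ^ (p / 2) := Real.rpow_nonneg ht.le _
    have h6 : radialDensity p U t * (x * Real.exp x) ≤ 32 * ε * (h t * E t) := by
      calc radialDensity p U t * (x * Real.exp x)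
          ≤ ((1 + t ^ (p / 2)) * Real.exp (4 * (ρ - δ * t / 8))) *
              (x * Real.exp (δ / 4 * t)) := by
            have := hUle t ht.le
            unfold radialDensity
            gcongr
        _ = (1 + t ^ (p / 2)) * x *
              (Real.exp (4 * (ρ - δ * t / 8)) * Real.exp (δ / 4 * t)) := by ring
        _ = (1 + t ^ (p / 2)) * x * (Real.exp (4 * ρ) * Real.exp (-(δ / 4 * t))) := by
            rw [← Real.exp_add, ← Real.exp_add]; ring_nf
        _ = 32 * ε * (h t * E t) := by simp only [hx, hh]; ring
    have h7 := radialDensity_nonneg p U ht.le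
    rw [h5]
    nlinarith
  have hEhint : IntegrableOn (fun t => h t * E t) (Set.Ioi 0) := by
    refine Integrable.mono' (hhint.mul_const B) (hhc.mul hEc).aestronglyMeasurable ?_
    filter_upwards [ae_restrict_mem measurableSet_Ioi] with t ht
    have ht : 0 < t := ht
    rw [Real.norm_eq_abs, abs_of_nonneg (mul_nonneg (hh0 t ht.le) (hEpos t).le)]
    exact mul_le_mul_of_nonneg_left (hEB t ht.le) (hh0 t ht.le)
  have hsumint : IntegrableOn (fun t => radialDensity p U t + 32 * ε * (h t * E t)) (Set.Ioi 0) :=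
    hU.integrable.add (hEhint.const_mul _)
  have hVint := integrableOn_radialDensity_of_le hVm hsumint hpt
  refine ⟨a + ε, V, by linarith, hVm, hVint, fun τ hτ => ?_, ?_⟩
  · have h1 : ∫ t in Set.Ioi (0 : ℝ), radialGreenKernel τ t * radialDensity p V t ≤
        ∫ t in Set.Ioi (0 : ℝ), (radialGreenKernel τ t * radialDensity p U t +
          (Set.Ioc 0 τ).indicator (fun t => ε * τ * (h t * E t)) t) := by
      refine setIntegral_mono_on (integrableOn_radialGreenKernel_mul hτ hVint)
        ((integrableOn_radialGreenKernel_mul hτ hU.integrable).add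
          ((hEhint.const_mul (ε * τ)).indicator measurableSet_Ioc)) measurableSet_Ioi
        fun t ht => ?_
      have ht : 0 < t := ht
      rcases le_or_gt t τ with htτ | htτ
      · rw [Set.indicator_of_mem (show t ∈ Set.Ioc 0 τ from ⟨ht, htτ⟩)]
        have h2 := radialGreenKernel_nonneg (τ := τ) ht
        have h3 := radialGreenKernel_le hτ ht
        have h4 : 0 ≤ 32 * ε * (h t * E t) :=
          mul_nonneg (by positivity) (mul_nonneg (hh0 t ht.le) (hEpos t).le)
        have h5 := mul_le_mul_of_nonneg_left (hpt t ht) h2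
        have h6 := mul_le_mul_of_nonneg_right h3 h4
        linarith
      · rw [radialGreenKernel_of_le htτ.le, Set.indicator_of_notMem (fun h => by
          exact absurd h.2 (not_le.2 htτ))]
        simp
    rw [integral_add (integrableOn_radialGreenKernel_mul hτ hU.integrable)
      ((hEhint.const_mul (ε * τ)).indicator measurableSet_Ioc),
      setIntegral_indicator measurableSet_Ioc, Set.inter_eq_right.2 Set.Ioc_subset_Ioi_self,
      integral_const_mul, ← intervalIntegral.integral_of_le hτ, hEint] at h1
    have h2 := hU.eq τ hτ
    unfold shootingMap at h2 ⊢
    simp only [hV]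
    rw [h2]
    linarith
  · have h1 : ∫ t in Set.Ioi (0 : ℝ), radialDensity p V t ≤
        ∫ t in Set.Ioi (0 : ℝ), (radialDensity p U t + 32 * ε * (h t * E t)) :=
      setIntegral_mono_on hVint hsumint measurableSet_Ioi fun t ht => hpt t ht
    have h2 : ∫ t in Set.Ioi (0 : ℝ), h t * E t ≤ ∫ t in Set.Ioi (0 : ℝ), h t * B :=
      setIntegral_mono_on hEhint (hhint.mul_const B) measurableSet_Ioi fun t ht =>
        mul_le_mul_of_nonneg_left (hEB t (le_of_lt ht)) (hh0 t (le_of_lt ht))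
    rw [integral_add hU.integrable (hEhint.const_mul _), integral_const_mul] at h1
    rw [integral_mul_const, ← hI] at h2
    have h3 := mul_le_mul_of_nonneg_left h2 (show 0 ≤ 8 * ε by positivity)
    linarith

/-- There is a radial solution with `Δ u → 0` at infinity. -/
lemma exists_shootingSol_mass_eq {p : ℝ} (hp : 0 < p) (ρ : ℝ) :
    ∃ a U, IsShootingSol p ρ a U ∧
      a + 1 / 4 * (∫ t in Set.Ioi (0 : ℝ), radialDensity p U t) = 0 := by
  obtain ⟨a, U, hU, hmax⟩ := exists_shootingSol_sSup hp ρ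
  refine ⟨a, U, hU, hU.mass_le.antisymm (not_lt.1 fun hlt => ?_)⟩
  obtain ⟨b, V, hab, hV⟩ := hU.exists_super_of_mass_lt hp hlt
  obtain ⟨W, hW⟩ := hV.exists_sol
  exact absurd (hmax b W hW) (not_le.2 hab)

/-! ### Finiteness of the total mass -/

lemma integrableOn_radialLogKernel_mul {τ : ℝ} (hτ : 0 ≤ τ) {F : ℝ → ℝ}
    (hF : IntegrableOn F (Set.Ioi 0)) :
    IntegrableOn (fun t => radialLogKernel τ t * F t) (Set.Ioi 0) := by
  refine Integrable.bdd_mul hF (c := τ / 4)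
    (measurable_radialLogKernel.comp (measurable_prodMk_left (x := τ))).aestronglyMeasurable ?_
  filter_upwards [ae_restrict_mem measurableSet_Ioi] with t ht
  rw [Real.norm_eq_abs, abs_of_nonneg (radialLogKernel_nonneg hτ ht)]
  exact radialLogKernel_le ht

lemma shootingMap_eq_of_mass_eq {p ρ a : ℝ} {V : ℝ → ℝ}
    (hV : IntegrableOn (radialDensity p V) (Set.Ioi 0))
    (ha : a + 1 / 4 * (∫ t in Set.Ioi (0 : ℝ), radialDensity p V t) = 0) {τ : ℝ} (hτ : 0 ≤ τ) :
    shootingMap p ρ a V τ =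
      ρ - 1 / 8 * ∫ t in Set.Ioi (0 : ℝ), radialLogKernel τ t * radialDensity p V t := by
  have h1 : ∀ t, radialGreenKernel τ t * radialDensity p V t =
      τ / 32 * radialDensity p V t - 1 / 8 * (radialLogKernel τ t * radialDensity p V t) := by
    intro t; unfold radialGreenKernel; ring
  unfold shootingMap
  simp_rw [h1]
  rw [integral_sub (hV.const_mul _) ((integrableOn_radialLogKernel_mul hτ hV).const_mul _),
    integral_const_mul, integral_const_mul]
  linear_combination τ / 8 * ha

lemma radialLogKernel_ge {τ T t : ℝ} (ht : 0 < t) (htT : t ≤ T) (hTτ : T ≤ τ) :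
    t / 2 * Real.log (τ / T) ≤ radialLogKernel τ t := by
  have hT : 0 < T := ht.trans_le htT
  have hτ : 0 < τ := hT.trans_le hTτ
  unfold radialLogKernel
  split_ifs with h
  · have : Real.log (τ / T) ≤ Real.log (τ / t) := Real.log_le_log (by positivity) (by gcongr)
    have h2 : 0 ≤ t ^ 2 / (4 * τ) := by positivity
    nlinarith
  · have h1 : T = τ := by linarith
    subst h1
    rw [div_self hT.ne']
    rw [Real.log_one, mul_zero]
    positivity

/-- The radial solution with `Δ u → 0` at infinity has finite total mass. -/
lemma IsShootingSol.integrableOn_mul {p ρ a : ℝ} (hp : 0 < p) {U : ℝ → ℝ}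
    (hU : IsShootingSol p ρ a U)
    (ha : a + 1 / 4 * (∫ t in Set.Ioi (0 : ℝ), radialDensity p U t) = 0) :
    IntegrableOn (fun t => t * radialDensity p U t) (Set.Ioi 0) := by
  have hFm := measurable_radialDensity p hU.measurable
  have hloc : ∀ T, IntegrableOn (fun t => t * radialDensity p U t) (Set.Ioc 0 T) := by
    intro T
    refine Integrable.bdd_mul (hU.integrable.mono_set Set.Ioc_subset_Ioi_self) (c := T)
      measurable_id.aestronglyMeasurable ?_
    filter_upwards [ae_restrict_mem measurableSet_Ioc] with t ht
    rw [Real.norm_eq_abs, abs_of_nonneg ht.1.le]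
    exact ht.2
  by_contra hnot
  -- Mass m inside [0, T] forces U ≤ ρ - (m/16) log(τ/T), hence e^{4U} ≤ C t^(-m/4). This m makes t
  -- · t^(p/2) · t^(-m/4) equal to t^(-2).
  set m : ℝ := 4 * (p / 2 + 3) with hm
  have hm0 : 0 < m := by positivity
  obtain ⟨T, hT1, hT⟩ : ∃ T : ℝ, 1 ≤ T ∧ m ≤ ∫ t in Set.Ioc 0 T, t * radialDensity p U t := by
    by_contra! hcon
    refine hnot (integrableOn_Ioi_of_intervalIntegral_norm_bounded m 0 hloc Filter.tendsto_id ?_)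
    filter_upwards [Filter.eventually_ge_atTop 1] with T hT
    have h0T : (0 : ℝ) ≤ T := zero_le_one.trans hT
    rw [intervalIntegral.integral_of_le h0T]
    refine le_trans (le_of_eq ?_) (hcon T hT).le
    refine setIntegral_congr_fun measurableSet_Ioc fun t ht => ?_
    simp only [Real.norm_eq_abs]
    rw [abs_of_nonneg (mul_nonneg ht.1.le (radialDensity_nonneg p U ht.1.le))]
  have hT0 : 0 < T := by linarith
  have hdec : ∀ τ, T ≤ τ → U τ ≤ ρ - m / 16 * Real.log (τ / T) := by
    intro τ hτ
    have hτ0 : 0 ≤ τ := hT0.le.trans hτ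
    have hlog : 0 ≤ Real.log (τ / T) := Real.log_nonneg ((one_le_div hT0).2 hτ)
    rw [hU.eq τ hτ0, shootingMap_eq_of_mass_eq hU.integrable ha hτ0]
    have h1 : Real.log (τ / T) / 2 * (∫ t in Set.Ioc 0 T, t * radialDensity p U t) ≤
        ∫ t in Set.Ioi (0 : ℝ), radialLogKernel τ t * radialDensity p U t := by
      rw [← integral_const_mul]
      calc _ ≤ ∫ t in Set.Ioc 0 T, radialLogKernel τ t * radialDensity p U t := by
            refine setIntegral_mono_on ((hloc T).const_mul _)
              ((integrableOn_radialLogKernel_mul hτ0 hU.integrable).mono_set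
                Set.Ioc_subset_Ioi_self) measurableSet_Ioc fun t ht => ?_
            have := mul_le_mul_of_nonneg_right (radialLogKernel_ge ht.1 ht.2 hτ)
              (radialDensity_nonneg p U ht.1.le)
            linarith
        _ ≤ _ := by
            refine setIntegral_mono_set (integrableOn_radialLogKernel_mul hτ0 hU.integrable) ?_
              (Filter.Eventually.of_forall Set.Ioc_subset_Ioi_self)
            filter_upwards [ae_restrict_mem measurableSet_Ioi] with t ht
            exact mul_nonneg (radialLogKernel_nonneg hτ0 ht)
              (radialDensity_nonneg p U (le_of_lt ht))
    nlinarith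
  have htail : IntegrableOn (fun t => t * radialDensity p U t) (Set.Ioi T) := by
    refine Integrable.mono' ((integrableOn_Ioi_rpow_of_lt (a := -2) (by norm_num) hT0).const_mul
      (2 * Real.exp (4 * ρ) * T ^ (m / 4))) (measurable_id.mul hFm).aestronglyMeasurable ?_
    filter_upwards [ae_restrict_mem measurableSet_Ioi] with t ht
    have ht : T < t := ht
    have ht0 : 0 < t := hT0.trans ht
    have ht1 : 1 ≤ t := hT1.trans ht.le
    rw [Real.norm_eq_abs, abs_of_nonneg (mul_nonneg ht0.le (radialDensity_nonneg p U ht0.le))]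
    have h1 : Real.exp (4 * U t) ≤ Real.exp (4 * ρ) * (T ^ (m / 4) * t ^ (-(m / 4))) := by
      have h2 : T ^ (m / 4) * t ^ (-(m / 4)) = Real.exp (-(m / 4) * Real.log (t / T)) := by
        rw [Real.log_div ht0.ne' hT0.ne', Real.rpow_def_of_pos hT0, Real.rpow_def_of_pos ht0,
          ← Real.exp_add]
        ring_nf
      rw [h2, ← Real.exp_add]
      refine Real.exp_le_exp.2 ?_
      linarith [hdec t ht.le]
    have h3 : 1 + t ^ (p / 2) ≤ 2 * t ^ (p / 2) := by
      linarith [Real.one_le_rpow ht1 (by positivity : 0 ≤ p / 2)]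
    have h4 : t * (t ^ (p / 2) * t ^ (-(m / 4))) = t ^ (-2 : ℝ) := by
      nth_rewrite 1 [← Real.rpow_one t]
      rw [← Real.rpow_add ht0, ← Real.rpow_add ht0]
      congr 1
      rw [hm]; ring
    have h5 : 0 ≤ t ^ (p / 2) := Real.rpow_nonneg ht0.le _
    calc t * radialDensity p U t
        ≤ t * ((2 * t ^ (p / 2)) * (Real.exp (4 * ρ) * (T ^ (m / 4) * t ^ (-(m / 4))))) := by
          unfold radialDensity; gcongr
      _ = 2 * Real.exp (4 * ρ) * T ^ (m / 4) * (t * (t ^ (p / 2) * t ^ (-(m / 4)))) := by ring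
      _ = _ := by rw [h4]
  refine hnot ?_
  rw [← Set.Ioc_union_Ioi_eq_Ioi hT0.le]
  exact (hloc T).union htail

/-! ### Smoothness across the origin -/

lemma contDiffOn_of_hasDerivAt_chain {s : Set ℝ} (hs : IsOpen s) (n : ℕ) (g : ℕ → ℝ → ℝ)
    (hd : ∀ i < n, ∀ x ∈ s, HasDerivAt (g i) (g (i + 1) x) x) (hc : ContinuousOn (g n) s) :
    ContDiffOn ℝ n (g 0) s := by
  induction n generalizing g with
  | zero => simpa using hc
  | succ n ih =>
    push_cast
    rw [contDiffOn_succ_iff_deriv_of_isOpen hs]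
    refine ⟨fun x hx => (hd 0 (by omega) x hx).differentiableAt.differentiableWithinAt, by simp, ?_⟩
    refine (ih (fun i => g (i + 1)) (fun i hi x hx => hd (i + 1) (by omega) x hx) hc).congr
      fun x hx => ?_
    exact (hd 0 (by omega) x hx).deriv

lemma iteratedDerivWithin_of_hasDerivAt_chain {s : Set ℝ} (hs : IsOpen s) (n : ℕ) (g : ℕ → ℝ → ℝ)
    (hd : ∀ i < n, ∀ x ∈ s, HasDerivAt (g i) (g (i + 1) x) x) :
    ∀ i ≤ n, Set.EqOn (iteratedDerivWithin i (g 0) s) (g i) s := by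
  intro i
  induction i with
  | zero => intro _ x _; simp
  | succ i ih =>
    intro hi x hx
    rw [iteratedDerivWithin_succ, derivWithin_congr (ih (by omega)) (ih (by omega) hx)]
    exact (hd i (by omega) x hx).hasDerivWithinAt.derivWithin (hs.uniqueDiffWithinAt hx)

lemma isLittleO_nhds_zero_pow {E G : Type*} [NormedAddCommGroup E] [NormedAddCommGroup G]
    {f : E → G} (h0 : f 0 = 0) {m n : ℕ} (hmn : m ≤ n)
    (h : f =o[nhdsWithin 0 {0}ᶜ] fun x => ‖x‖ ^ n) : f =o[nhds 0] fun x => ‖x‖ ^ m := by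
  have h2 : (fun x : E => ‖x‖ ^ n) =O[nhdsWithin 0 {0}ᶜ] fun x => ‖x‖ ^ m := by
    refine Asymptotics.IsBigO.of_bound 1 ?_
    have : ∀ᶠ x : E in nhdsWithin 0 {0}ᶜ, x ∈ Metric.ball (0 : E) 1 :=
      Filter.Eventually.filter_mono nhdsWithin_le_nhds (Metric.ball_mem_nhds (0 : E) one_pos)
    filter_upwards [this] with x hx
    rw [mem_ball_zero_iff] at hx
    rw [norm_pow, norm_pow, norm_norm, one_mul]
    exact pow_le_pow_of_le_one (norm_nonneg x) hx.le hmn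
  have h3 := h.trans_isBigO h2
  rw [Asymptotics.isLittleO_iff] at h3 ⊢
  intro c hc
  have h4 := h3 hc
  rw [eventually_nhdsWithin_iff] at h4
  filter_upwards [h4] with x hx
  rcases eq_or_ne x 0 with rfl | hne
  · rw [h0, norm_zero]; positivity
  · exact hx hne

/-- A function that is `C^n` away from the origin, and whose derivatives of order `k ≤ n` are
`o(|x|^(n-k))` at the origin, is `C^n`. -/
lemma contDiff_of_isLittleO_iteratedFDeriv {E : Type} [NormedAddCommGroup E] [NormedSpace ℝ E]
    (n : ℕ) {G : Type} [NormedAddCommGroup G] [NormedSpace ℝ G] (f : E → G)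
    (hf : ContDiffOn ℝ n f {0}ᶜ) (h0 : f 0 = 0)
    (ho : ∀ k ≤ n, (fun x => iteratedFDeriv ℝ k f x) =o[nhdsWithin 0 {0}ᶜ] fun x => ‖x‖ ^ (n - k)) :
    ContDiff ℝ n f := by
  have hopen : IsOpen ({0}ᶜ : Set E) := isOpen_compl_singleton
  induction n generalizing G with
  | zero =>
    have ho0 := (ho 0 le_rfl).norm_left
    simp only [norm_iteratedFDeriv_zero, Nat.sub_zero] at ho0
    have := isLittleO_nhds_zero_pow h0 le_rfl ho0.of_norm_left
    rw [Nat.cast_zero, contDiff_zero, continuous_iff_continuousAt]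
    intro x
    rcases eq_or_ne x 0 with rfl | hne
    · simp only [pow_zero] at this
      rw [ContinuousAt, h0]
      exact (Asymptotics.isLittleO_one_iff ℝ).1 this
    · exact (hf.continuousOn.continuousAt (hopen.mem_nhds hne))
  | succ n ih =>
    -- The derivative at the origin is 0, so `fderiv ℝ f` satisfies the same hypotheses with one
    -- order less.
    have hd0 : HasFDerivAt f (0 : E →L[ℝ] G) 0 := by
      have ho0 := (ho 0 (Nat.zero_le _)).norm_left
      simp only [norm_iteratedFDeriv_zero, Nat.sub_zero] at ho0
      have := isLittleO_nhds_zero_pow h0 (show 1 ≤ n + 1 by omega) ho0.of_norm_left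
      rw [hasFDerivAt_iff_isLittleO_nhds_zero]
      simp only [pow_one] at this
      simpa [h0] using this.of_norm_right
    have hf' : ContDiffOn ℝ n (fderiv ℝ f) {0}ᶜ :=
      hf.fderiv_of_isOpen hopen (by norm_cast)
    push_cast
    rw [contDiff_succ_iff_fderiv]
    refine ⟨fun x => ?_, by simp, ?_⟩
    · rcases eq_or_ne x 0 with rfl | hne
      · exact hd0.differentiableAt
      · exact ((hf.contDiffAt (hopen.mem_nhds hne)).differentiableAt (by simp))
    · refine ih (fderiv ℝ f) hf' hd0.fderiv fun k hk => ?_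
      have := (ho (k + 1) (by omega)).norm_left
      simp only [← norm_iteratedFDeriv_fderiv, Nat.add_sub_add_right] at this
      exact this.of_norm_left

/-- The first two derivatives have norms 2/|x| and at most 2/|x|², and the higher ones vanish. The
geometric form is what `norm_iteratedFDerivWithin_comp_le` needs. -/
lemma norm_iteratedFDeriv_const_mul_norm_sq_le {c : ℝ} {x : R4} (hx : x ≠ 0)
    (hc : c = (‖x‖ ^ 2)⁻¹) {i : ℕ} (hi : 1 ≤ i) :
    ‖iteratedFDeriv ℝ i (fun y : R4 => c * ‖y‖ ^ 2) x‖ ≤ (2 / ‖x‖) ^ i := by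
  have hx0 : 0 < ‖x‖ := norm_pos_iff.2 hx
  have hc0 : 0 < c := by rw [hc]; positivity
  set L : R4 →L[ℝ] R4 →L[ℝ] ℝ := (c * 2) • innerSL ℝ with hL
  have hLapp : ∀ y v, L y v = c * 2 * inner ℝ y v := fun _ _ => rfl
  have hLn : ∀ y, ‖L y‖ = c * 2 * ‖y‖ := by
    intro y
    rw [hL, FunLike.coe_smul, Pi.smul_apply, norm_smul, innerSL_apply_norm, Real.norm_eq_abs,
      abs_of_pos (by positivity)]
  have hfd : fderiv ℝ (fun y : R4 => c * ‖y‖ ^ 2) = L := by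
    ext1 y
    have h := ((hasStrictFDerivAt_norm_sq y).hasFDerivAt.const_mul c).fderiv
    rw [h]
    ext v
    rw [hLapp]
    simp
    ring
  obtain ⟨j, rfl⟩ : ∃ j, i = j + 1 := ⟨i - 1, by omega⟩
  rw [← norm_iteratedFDeriv_fderiv, hfd]
  rcases j with _ | j
  · rw [norm_iteratedFDeriv_zero, hLn, hc]
    refine le_of_eq ?_
    rw [zero_add, pow_one]
    field_simp
  · rw [← norm_iteratedFDeriv_fderiv]
    have : fderiv ℝ L = fun _ => L := by ext1 y; exact L.fderiv
    rw [this]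
    rcases j with _ | j
    · rw [norm_iteratedFDeriv_zero]
      refine (L.opNorm_le_bound (by positivity) fun y => (hLn y).le).trans ?_
      rw [hc, div_pow, inv_mul_eq_div]
      gcongr
      norm_num
    · rw [iteratedFDeriv_const_of_ne (by omega)]
      simp only [Pi.zero_apply, norm_zero]
      positivity

/-- Composition with `|x|²` of a function with `g^(i)(τ) τ^i = o(τ²)` at `0` is `C⁴`. -/
lemma contDiff_comp_norm_sq_of_isLittleO (g : ℕ → ℝ → ℝ) (h0 : g 0 0 = 0)
    (hd : ∀ i < 4, ∀ τ, 0 < τ → HasDerivAt (g i) (g (i + 1) τ) τ)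
    (hc : ContinuousOn (g 4) (Set.Ioi 0))
    (ho : ∀ ε > 0, ∃ δ > 0, ∀ τ, 0 < τ → τ < δ → ∀ i ≤ 4, |g i τ| * τ ^ i ≤ ε * τ ^ 2) :
    ContDiff ℝ 4 fun x : R4 => g 0 (‖x‖ ^ 2) := by
  have hg : ContDiffOn ℝ 4 (g 0) (Set.Ioi 0) :=
    contDiffOn_of_hasDerivAt_chain isOpen_Ioi 4 g (fun i hi τ hτ => hd i hi τ hτ) hc
  have hopen : IsOpen ({0}ᶜ : Set R4) := isOpen_compl_singleton
  refine contDiff_of_isLittleO_iteratedFDeriv 4 _ ?_ (by simpa using h0) ?_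
  · refine hg.comp (contDiff_norm_sq ℝ).contDiffOn fun x hx => ?_
    exact pow_pos (norm_pos_iff.2 hx) 2
  intro k hk
  rw [Asymptotics.isLittleO_iff]
  intro ε hε
  -- The factor k! 2^k cancels the constants of the composition bound.
  obtain ⟨δ, hδ, hbound⟩ := ho (ε / (k.factorial * 2 ^ k)) (by positivity)
  have hev : ∀ᶠ x : R4 in nhdsWithin 0 {0}ᶜ, x ∈ Metric.ball (0 : R4) (Real.sqrt δ) :=
    Filter.Eventually.filter_mono nhdsWithin_le_nhds
      (Metric.ball_mem_nhds _ (Real.sqrt_pos.2 hδ))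
  filter_upwards [hev, self_mem_nhdsWithin] with x hxδ hx
  have hx : x ≠ 0 := hx
  have hx0 : 0 < ‖x‖ := norm_pos_iff.2 hx
  rw [mem_ball_zero_iff, Real.lt_sqrt (norm_nonneg x)] at hxδ
  set r2 : ℝ := ‖x‖ ^ 2 with hr2
  have hr2pos : 0 < r2 := by positivity
  -- Rescaling by |x|² makes the inner function equal to 1 at x; the outer derivatives there become
  -- r2^i g_i(r2), the quantities controlled by `ho`.
  have hchain : ∀ i < 4, ∀ s ∈ Set.Ioi (0 : ℝ),
      HasDerivAt (fun s => r2 ^ i * g i (r2 * s)) (r2 ^ (i + 1) * g (i + 1) (r2 * s)) s := by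
    intro i hi s hs
    have h1 := (hd i hi (r2 * s) (mul_pos hr2pos hs)).comp s ((hasDerivAt_id s).const_mul r2)
    refine (h1.const_mul (r2 ^ i)).congr_deriv ?_
    ring
  have hGc : ContDiffOn ℝ 4 (fun s => g 0 (r2 * s)) (Set.Ioi 0) :=
    hg.comp (by fun_prop) fun s hs => mul_pos hr2pos hs
  have hiter := iteratedDerivWithin_of_hasDerivAt_chain isOpen_Ioi 4
    (fun i s => r2 ^ i * g i (r2 * s)) hchain
  have hcomp : (fun y : R4 => g 0 (‖y‖ ^ 2)) =
      (fun s => g 0 (r2 * s)) ∘ fun y : R4 => r2⁻¹ * ‖y‖ ^ 2 := by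
    ext y
    simp only [Function.comp]
    rw [mul_inv_cancel_left₀ hr2pos.ne']
  have hfx : r2⁻¹ * ‖x‖ ^ 2 = 1 := inv_mul_cancel₀ hr2pos.ne'
  have hle := norm_iteratedFDerivWithin_comp_le (𝕜 := ℝ) (N := 4) (n := k)
    (g := fun s => g 0 (r2 * s)) (f := fun y : R4 => r2⁻¹ * ‖y‖ ^ 2) (t := Set.Ioi 0)
    (s := {0}ᶜ) (x := x) (C := ε / (k.factorial * 2 ^ k) * r2 ^ 2) (D := 2 / ‖x‖) hGc
    ((contDiff_const.mul (contDiff_norm_sq ℝ)).contDiffOn) (by exact_mod_cast hk)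
    isOpen_Ioi.uniqueDiffOn hopen.uniqueDiffOn
    (fun y hy => mul_pos (inv_pos.2 hr2pos) (pow_pos (norm_pos_iff.2 hy) 2)) hx ?_ ?_
  · rw [iteratedFDerivWithin_of_isOpen k hopen hx, ← hcomp] at hle
    refine hle.trans (le_of_eq ?_)
    rw [norm_pow, norm_norm, hr2]
    have h4 : ‖x‖ ^ 4 = ‖x‖ ^ (4 - k) * ‖x‖ ^ k := by rw [← pow_add]; congr 1; omega
    have h5 : (‖x‖ ^ 2) ^ 2 = ‖x‖ ^ (4 - k) * ‖x‖ ^ k := by rw [← h4]; ring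
    rw [h5, div_pow]
    field_simp
  · intro i hi
    rw [hfx, norm_iteratedFDerivWithin_eq_norm_iteratedDerivWithin]
    have h1 := hiter i (by omega) (Set.mem_Ioi.2 (one_pos (α := ℝ)))
    simp only [pow_zero, one_mul] at h1
    rw [h1, mul_one, Real.norm_eq_abs, abs_mul, abs_of_pos (pow_pos hr2pos i), mul_comm]
    exact hbound r2 hr2pos hxδ i (by omega)
  · intro i hi _
    rw [iteratedFDerivWithin_of_isOpen i hopen hx]
    exact norm_iteratedFDeriv_const_mul_norm_sq_le hx rfl hi

lemma laplacian_comp_norm_sq {g g₁ : ℝ → ℝ} {g₂ : ℝ} {x : R4}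
    (h : ∀ᶠ τ in nhds (‖x‖ ^ 2), HasDerivAt g (g₁ τ) τ) (h₁ : HasDerivAt g₁ g₂ (‖x‖ ^ 2)) :
    Laplacian.laplacian (fun y : R4 => g (‖y‖ ^ 2)) x = 4 * ‖x‖ ^ 2 * g₂ + 8 * g₁ (‖x‖ ^ 2) := by
  have hcont : Filter.Tendsto (fun y : R4 => ‖y‖ ^ 2) (nhds x) (nhds (‖x‖ ^ 2)) :=
    (continuous_norm.pow 2).tendsto x
  set L : R4 →L[ℝ] R4 →L[ℝ] ℝ := innerSL ℝ with hL
  have hLapp : ∀ y v, L y v = inner ℝ y v := fun _ _ => rfl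
  have hfd : fderiv ℝ (fun y : R4 => g (‖y‖ ^ 2)) =ᶠ[nhds x] fun y => (2 * g₁ (‖y‖ ^ 2)) • L y := by
    filter_upwards [hcont.eventually h] with y hy
    have h2 := (hy.comp_hasFDerivAt y (hasStrictFDerivAt_norm_sq y).hasFDerivAt).fderiv
    rw [Function.comp_def] at h2
    rw [h2]
    ext v
    simp [hLapp]
    ring
  have hg1 : HasFDerivAt (fun y : R4 => 2 * g₁ (‖y‖ ^ 2)) ((4 * g₂) • L x) x := by
    refine ((h₁.comp_hasFDerivAt x (hasStrictFDerivAt_norm_sq x).hasFDerivAt).const_mul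
      2).congr_fderiv ?_
    ext v
    simp [hLapp]
    ring
  have hfd2 : fderiv ℝ (fderiv ℝ (fun y : R4 => g (‖y‖ ^ 2))) x =
      (2 * g₁ (‖x‖ ^ 2)) • L + ((4 * g₂) • L x).smulRight (L x) := by
    rw [hfd.fderiv_eq]
    exact (hg1.smul L.hasFDerivAt).fderiv
  have hsum : ‖x‖ ^ 2 = x 0 ^ 2 + x 1 ^ 2 + x 2 ^ 2 + x 3 ^ 2 := by
    rw [EuclideanSpace.norm_sq_eq]
    simp [Fin.sum_univ_four]
  rw [laplacian_eq_iteratedFDeriv_orthonormalBasis _ (EuclideanSpace.basisFun (Fin 4) ℝ)]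
  simp only [iteratedFDeriv_two_apply, hfd2]
  simp [Fin.sum_univ_four, hLapp, EuclideanSpace.inner_single_right]
  linear_combination (-(4 * g₂)) * hsum

/-! ### The Green potential and the bilaplacian -/

/-- Moments of `F` over `[0, τ]`. -/
noncomputable def momentIntegral (F : ℝ → ℝ) (j : ℕ) (τ : ℝ) : ℝ := ∫ t in (0 : ℝ)..τ, t ^ j * F t

/-- The radial Green potential of `F` and its successive derivatives on `(0, ∞)`. -/
noncomputable def greenDeriv (F : ℝ → ℝ) : ℕ → ℝ → ℝ
  | 0 => fun τ => ∫ t in Set.Ioi (0 : ℝ), radialGreenKernel τ t * F t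
  | 1 => fun τ => 1 / 32 * (momentIntegral F 0 τ + momentIntegral F 2 τ / τ ^ 2
      - 2 * momentIntegral F 1 τ / τ)
  | 2 => fun τ => 1 / 16 * (momentIntegral F 1 τ / τ ^ 2 - momentIntegral F 2 τ / τ ^ 3)
  | 3 => fun τ => 1 / 16 * (-2 * momentIntegral F 1 τ / τ ^ 3 + 3 * momentIntegral F 2 τ / τ ^ 4)
  | 4 => fun τ => 1 / 16 * (F τ / τ ^ 2 + 6 * momentIntegral F 1 τ / τ ^ 4
      - 12 * momentIntegral F 2 τ / τ ^ 5)
  | _ => 0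

lemma greenDeriv_zero_eq_intervalIntegral (F : ℝ → ℝ) {τ : ℝ} (hτ : 0 ≤ τ) :
    greenDeriv F 0 τ = ∫ t in (0 : ℝ)..τ, radialGreenKernel τ t * F t := by
  rw [intervalIntegral.integral_of_le hτ]
  simp only [greenDeriv]
  refine (setIntegral_eq_of_subset_of_forall_sdiff_eq_zero measurableSet_Ioi
    Set.Ioc_subset_Ioi_self fun t ht => ?_)
  have h1 : 0 < t := ht.1
  have h2 : τ ≤ t := by
    by_contra h
    exact ht.2 ⟨h1, (not_le.1 h).le⟩
  rw [radialGreenKernel_of_le h2, zero_mul]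

/-- Splitting log(τ/t) moves all dependence on τ out of the integrands, so the fundamental theorem
of calculus applies termwise. -/
lemma greenDeriv_zero_eq {F : ℝ → ℝ} (hF : Continuous F) {τ : ℝ} (hτ : 0 < τ) :
    greenDeriv F 0 τ = 1 / 32 * (τ * momentIntegral F 0 τ - momentIntegral F 2 τ / τ
      - 2 * Real.log τ * momentIntegral F 1 τ
      + 2 * ∫ t in (0 : ℝ)..τ, t * Real.log t * F t) := by
  have hmom : ∀ (c : ℝ) (j : ℕ), IntervalIntegrable (fun t => c * (t ^ j * F t)) volume 0 τ :=
    fun c j => Continuous.intervalIntegrable (by fun_prop) _ _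
  have hlog : IntervalIntegrable (fun t => 1 / 16 * (t * Real.log t * F t)) volume 0 τ :=
    (continuous_const.mul (Real.continuous_mul_log.mul hF)).intervalIntegrable _ _
  have key : ∫ t in (0 : ℝ)..τ, radialGreenKernel τ t * F t =
      ∫ t in (0 : ℝ)..τ, ((τ / 32 * (t ^ 0 * F t) - 1 / (32 * τ) * (t ^ 2 * F t)
        - Real.log τ / 16 * (t ^ 1 * F t)) + 1 / 16 * (t * Real.log t * F t)) := by
    rw [intervalIntegral.integral_of_le hτ.le, intervalIntegral.integral_of_le hτ.le,
      integral_Ioc_eq_integral_Ioo, integral_Ioc_eq_integral_Ioo]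
    refine setIntegral_congr_fun measurableSet_Ioo fun t ht => ?_
    have ht0 : t ≠ 0 := ht.1.ne'
    simp only [radialGreenKernel, radialLogKernel, if_pos ht.2, Real.log_div hτ.ne' ht0]
    field_simp
    ring
  rw [greenDeriv_zero_eq_intervalIntegral F hτ.le, key,
    intervalIntegral.integral_add (((hmom _ _).sub (hmom _ _)).sub (hmom _ _)) hlog,
    intervalIntegral.integral_sub ((hmom _ _).sub (hmom _ _)) (hmom _ _),
    intervalIntegral.integral_sub (hmom _ _) (hmom _ _)]
  simp only [intervalIntegral.integral_const_mul]
  unfold momentIntegral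
  field_simp
  ring

lemma hasDerivAt_momentIntegral {F : ℝ → ℝ} (hF : Continuous F) (j : ℕ) (τ : ℝ) :
    HasDerivAt (momentIntegral F j) (τ ^ j * F τ) τ := by
  have hc : Continuous fun t => t ^ j * F t := by fun_prop
  exact intervalIntegral.integral_hasDerivAt_right (hc.intervalIntegrable _ _)
    (hc.stronglyMeasurableAtFilter _ _) hc.continuousAt

/-- For t < τ the τ-derivative of the kernel is (1 - t/τ)²/32, with a double zero at t = τ. Hence F
itself appears only in the fourth derivative, and its continuity suffices. -/
lemma hasDerivAt_greenDeriv {F : ℝ → ℝ} (hF : Continuous F) {i : ℕ} (hi : i < 4) {τ : ℝ}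
    (hτ : 0 < τ) : HasDerivAt (greenDeriv F i) (greenDeriv F (i + 1) τ) τ := by
  have h0 := hasDerivAt_momentIntegral hF 0 τ
  have h1 := hasDerivAt_momentIntegral hF 1 τ
  have h2 := hasDerivAt_momentIntegral hF 2 τ
  have hid := hasDerivAt_id τ
  have hτ' : τ ≠ 0 := hτ.ne'
  interval_cases i
  · have hc : Continuous fun t => t * Real.log t * F t := Real.continuous_mul_log.mul hF
    have hL : HasDerivAt (fun τ => ∫ t in (0 : ℝ)..τ, t * Real.log t * F t)
        (τ * Real.log τ * F τ) τ :=
      intervalIntegral.integral_hasDerivAt_right (hc.intervalIntegrable _ _)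
        (hc.stronglyMeasurableAtFilter _ _) hc.continuousAt
    have := ((((hid.mul h0).sub (h2.div hid hτ')).sub
      (((Real.hasDerivAt_log hτ').const_mul 2).mul h1)).add (hL.const_mul 2)).const_mul (1 / 32)
    refine (this.congr_deriv ?_).congr_of_eventuallyEq ?_
    · simp only [greenDeriv, id]
      field_simp
      ring
    · filter_upwards [lt_mem_nhds hτ] with s hs
      rw [greenDeriv_zero_eq hF hs]
      simp
  · have := ((h0.add (h2.div (hid.pow 2) (pow_ne_zero 2 hτ'))).sub
      ((h1.const_mul 2).div hid hτ')).const_mul (1 / 32)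
    refine this.congr_deriv ?_
    simp only [greenDeriv, id, Pi.pow_apply]
    field_simp
    ring
  · have := ((h1.div (hid.pow 2) (pow_ne_zero 2 hτ')).sub
      (h2.div (hid.pow 3) (pow_ne_zero 3 hτ'))).const_mul (1 / 16)
    refine this.congr_deriv ?_
    simp only [greenDeriv, id, Pi.pow_apply]
    field_simp
    ring
  · have := (((h1.const_mul (-2)).div (hid.pow 3) (pow_ne_zero 3 hτ')).add
      ((h2.const_mul 3).div (hid.pow 4) (pow_ne_zero 4 hτ'))).const_mul (1 / 16)
    refine this.congr_deriv ?_
    simp only [greenDeriv, id, Pi.pow_apply]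
    field_simp
    ring

lemma continuousOn_greenDeriv_four {F : ℝ → ℝ} (hF : Continuous F) :
    ContinuousOn (greenDeriv F 4) (Set.Ioi 0) := by
  have h : ∀ j, Continuous (momentIntegral F j) := fun j =>
    continuous_iff_continuousAt.2 fun τ => (hasDerivAt_momentIntegral hF j τ).continuousAt
  have hne : ∀ (n : ℕ), ∀ τ ∈ Set.Ioi (0 : ℝ), τ ^ n ≠ 0 := fun n τ hτ =>
    pow_ne_zero n (ne_of_gt hτ)
  have h1 := h 1
  have h2 := h 2
  simp only [greenDeriv]
  refine continuousOn_const.mul (((ContinuousOn.div (by fun_prop) (by fun_prop) (hne 2)).add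
    (ContinuousOn.div (by fun_prop) (by fun_prop) (hne 4))).sub
    (ContinuousOn.div (by fun_prop) (by fun_prop) (hne 5)))

lemma abs_momentIntegral_le {F : ℝ → ℝ} {η τ : ℝ} (hτ : 0 ≤ τ)
    (hη : ∀ t, 0 ≤ t → t ≤ τ → |F t| ≤ η) (j : ℕ) :
    |momentIntegral F j τ| ≤ η * τ ^ (j + 1) := by
  have := intervalIntegral.norm_integral_le_of_norm_le_const (a := 0) (b := τ)
    (f := fun t => t ^ j * F t) (C := τ ^ j * η) fun t ht => by
      rw [Set.uIoc_of_le hτ] at ht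
      rw [norm_mul, Real.norm_eq_abs, Real.norm_eq_abs, abs_of_nonneg (pow_nonneg ht.1.le j)]
      have h1 := ht.1.le
      have h2 := ht.2
      have h3 := hη t h1 h2
      gcongr
  rw [sub_zero, abs_of_nonneg hτ, Real.norm_eq_abs] at this
  unfold momentIntegral
  refine this.trans (le_of_eq ?_)
  ring

lemma abs_greenDeriv_mul_pow_le {F : ℝ → ℝ} {η τ : ℝ} (hτ : 0 < τ)
    (hη : ∀ t, 0 ≤ t → t ≤ τ → |F t| ≤ η) {i : ℕ} (hi : i ≤ 4) :
    |greenDeriv F i τ| * τ ^ i ≤ 2 * η * τ ^ 2 := by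
  have m0 := abs_momentIntegral_le hτ.le hη 0
  have m1 := abs_momentIntegral_le hτ.le hη 1
  have m2 := abs_momentIntegral_le hτ.le hη 2
  have hη0 : 0 ≤ η := (abs_nonneg _).trans (hη 0 le_rfl hτ.le)
  have hητ : 0 ≤ η * τ ^ 2 := by positivity
  have key : ∀ i, |greenDeriv F i τ| * τ ^ i = |greenDeriv F i τ * τ ^ i| := fun i => by
    rw [abs_mul, abs_of_pos (pow_pos hτ i)]
  have e1 : |momentIntegral F 1 τ| ≤ η * τ ^ 2 := m1
  have e0 : |τ * momentIntegral F 0 τ| ≤ η * τ ^ 2 := by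
    rw [abs_mul, abs_of_pos hτ]
    calc τ * |momentIntegral F 0 τ| ≤ τ * (η * τ ^ (0 + 1)) := by gcongr
      _ = η * τ ^ 2 := by ring
  have e2 : |momentIntegral F 2 τ / τ| ≤ η * τ ^ 2 := by
    rw [abs_div, abs_of_pos hτ, div_le_iff₀ hτ]
    refine m2.trans (le_of_eq (by ring))
  rw [abs_le] at e0 e1 e2
  interval_cases i
  · rw [pow_zero, mul_one, greenDeriv_zero_eq_intervalIntegral F hτ.le]
    have := intervalIntegral.norm_integral_le_of_norm_le_const (a := 0) (b := τ)
      (f := fun t => radialGreenKernel τ t * F t) (C := τ / 32 * η) fun t ht => by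
        rw [Set.uIoc_of_le hτ.le] at ht
        rw [norm_mul, Real.norm_eq_abs, Real.norm_eq_abs,
          abs_of_nonneg (radialGreenKernel_nonneg ht.1)]
        have h2 := radialGreenKernel_le hτ.le ht.1
        have h3 := hη t ht.1.le ht.2
        gcongr
    rw [sub_zero, abs_of_pos hτ, Real.norm_eq_abs] at this
    refine this.trans ?_
    linarith
  · rw [key]
    have : greenDeriv F 1 τ * τ ^ 1 = 1 / 32 * (τ * momentIntegral F 0 τ
        + momentIntegral F 2 τ / τ - 2 * momentIntegral F 1 τ) := by
      simp only [greenDeriv]; field_simp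
    rw [this, abs_le]
    constructor <;> linarith
  · rw [key]
    have : greenDeriv F 2 τ * τ ^ 2 = 1 / 16 * (momentIntegral F 1 τ
        - momentIntegral F 2 τ / τ) := by
      simp only [greenDeriv]; field_simp
    rw [this, abs_le]
    constructor <;> linarith
  · rw [key]
    have : greenDeriv F 3 τ * τ ^ 3 = 1 / 16 * (-2 * momentIntegral F 1 τ
        + 3 * (momentIntegral F 2 τ / τ)) := by
      simp only [greenDeriv]; field_simp
    rw [this, abs_le]
    constructor <;> linarith
  · rw [key]
    have e4 : |F τ * τ ^ 2| ≤ η * τ ^ 2 := by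
      rw [abs_mul, abs_of_pos (pow_pos hτ 2)]
      have := hη τ hτ.le le_rfl
      gcongr
    rw [abs_le] at e4
    have : greenDeriv F 4 τ * τ ^ 4 = 1 / 16 * (F τ * τ ^ 2 + 6 * momentIntegral F 1 τ
        - 12 * (momentIntegral F 2 τ / τ)) := by
      simp only [greenDeriv]; field_simp
    rw [this, abs_le]
    constructor <;> linarith

/-- The i-th derivative times τ^i is at most 2τ² sup |F| over [0, τ], which is o(τ²) because F
vanishes at 0. -/
lemma contDiff_greenDeriv_zero_of_apply_zero {F : ℝ → ℝ} (hF : Continuous F) (hF0 : F 0 = 0) :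
    ContDiff ℝ 4 fun x : R4 => greenDeriv F 0 (‖x‖ ^ 2) := by
  refine contDiff_comp_norm_sq_of_isLittleO (greenDeriv F) ?_
    (fun i hi τ hτ => hasDerivAt_greenDeriv hF hi hτ) (continuousOn_greenDeriv_four hF) ?_
  · rw [greenDeriv_zero_eq_intervalIntegral F le_rfl, intervalIntegral.integral_same]
  · intro ε hε
    obtain ⟨δ, hδ, h⟩ := Metric.continuousAt_iff.1 hF.continuousAt (ε / 2) (by positivity)
    refine ⟨δ, hδ, fun τ hτ hτδ i hi => ?_⟩
    have := abs_greenDeriv_mul_pow_le (F := F) (η := ε / 2) hτ (fun t h0 h1 => ?_) hi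
    · linarith
    · have h2 := h (x := t) (by rw [Real.dist_eq, sub_zero, abs_of_nonneg h0]; linarith)
      rw [Real.dist_eq, hF0, sub_zero] at h2
      exact h2.le

lemma integral_mul_log {τ : ℝ} (hτ : 0 < τ) :
    ∫ t in (0 : ℝ)..τ, t * Real.log t = τ ^ 2 / 2 * Real.log τ - τ ^ 2 / 4 := by
  have := intervalIntegral.integral_eq_sub_of_hasDerivAt_of_le (a := 0) (b := τ)
    (f := fun t => t / 2 * (t * Real.log t) - t ^ 2 / 4) (f' := fun t => t * Real.log t) hτ.le
    (Continuous.continuousOn (by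
      have := Real.continuous_mul_log
      fun_prop)) (fun t ht => ?_) (Real.continuous_mul_log.intervalIntegrable _ _)
  · rw [this]; simp; ring
  · have h1 := ((((hasDerivAt_id t).div_const 2).mul
      ((hasDerivAt_id t).mul (Real.hasDerivAt_log ht.1.ne'))).sub
      (((hasDerivAt_id t).pow 2).div_const 4))
    refine h1.congr_deriv ?_
    have := ht.1.ne'
    simp only [id, Pi.mul_apply]
    field_simp
    ring

lemma greenDeriv_zero_one {τ : ℝ} (hτ : 0 ≤ τ) :
    greenDeriv (fun _ => 1) 0 τ = τ ^ 2 / 192 := by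
  rcases hτ.eq_or_lt with rfl | hτ
  · rw [greenDeriv_zero_eq_intervalIntegral _ le_rfl]; simp
  rw [greenDeriv_zero_eq continuous_const hτ]
  unfold momentIntegral
  simp only [mul_one, integral_pow, integral_mul_log hτ]
  field_simp
  ring

lemma intervalIntegrable_radialGreenKernel_mul {F : ℝ → ℝ} (hF : Continuous F) {τ : ℝ}
    (hτ : 0 ≤ τ) : IntervalIntegrable (fun t => radialGreenKernel τ t * F t) volume 0 τ := by
  rw [intervalIntegrable_iff_integrableOn_Ioc_of_le hτ]
  refine Integrable.bdd_mul (hF.integrableOn_Ioc) (c := τ / 32)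
    (measurable_radialGreenKernel.comp (measurable_prodMk_left (x := τ))).aestronglyMeasurable ?_
  filter_upwards [ae_restrict_mem measurableSet_Ioc] with t ht
  rw [Real.norm_eq_abs, abs_of_nonneg (radialGreenKernel_nonneg ht.1)]
  exact radialGreenKernel_le hτ ht.1

/-- Subtracting F(0) reduces to a density vanishing at 0; the constant part contributes a multiple
of |x|⁴. -/
lemma contDiff_greenDeriv_zero {F : ℝ → ℝ} (hF : Continuous F) :
    ContDiff ℝ 4 fun x : R4 => greenDeriv F 0 (‖x‖ ^ 2) := by
  have hdec : (fun x : R4 => greenDeriv F 0 (‖x‖ ^ 2)) = fun x : R4 =>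
      greenDeriv (fun t => F t - F 0) 0 (‖x‖ ^ 2) + F 0 * ((‖x‖ ^ 2) ^ 2 / 192) := by
    ext x
    have hx : 0 ≤ ‖x‖ ^ 2 := by positivity
    have hF' : Continuous fun t => F t - F 0 := by fun_prop
    rw [← greenDeriv_zero_one hx, greenDeriv_zero_eq_intervalIntegral _ hx,
      greenDeriv_zero_eq_intervalIntegral _ hx, greenDeriv_zero_eq_intervalIntegral _ hx,
      ← intervalIntegral.integral_const_mul, ← intervalIntegral.integral_add
        (intervalIntegrable_radialGreenKernel_mul hF' hx)
        ((intervalIntegrable_radialGreenKernel_mul continuous_const hx).const_mul _)]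
    refine intervalIntegral.integral_congr fun t _ => ?_
    ring
  rw [hdec]
  refine (contDiff_greenDeriv_zero_of_apply_zero (by fun_prop) (by simp)).add ?_
  have := contDiff_norm_sq (E := R4) (n := 4) ℝ
  fun_prop

lemma ContDiff.laplacian {n : WithTop ℕ∞} {u : R4 → ℝ} (hu : ContDiff ℝ (n + 2) u) :
    ContDiff ℝ n (Laplacian.laplacian u) := by
  rw [laplacian_eq_iteratedFDeriv_orthonormalBasis _ (EuclideanSpace.basisFun (Fin 4) ℝ)]
  refine ContDiff.sum fun i _ => ?_
  have h := hu.iteratedFDeriv_right (i := 2) (m := n) le_rfl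
  exact (ContinuousMultilinearMap.apply ℝ (fun _ : Fin 2 => R4) ℝ _).contDiff.comp h

/-- A radial function given by the Green potential of `F` is a `C⁴` solution of
`Δ² u = F(|x|²)`. -/
lemma bilaplacian_greenDeriv {F : ℝ → ℝ} (hF : Continuous F) (c₀ c₁ : ℝ) :
    ContDiff ℝ 4 (fun x : R4 => c₀ + c₁ * ‖x‖ ^ 2 + greenDeriv F 0 (‖x‖ ^ 2)) ∧
    ∀ x : R4, Laplacian.laplacian (Laplacian.laplacian
      (fun x : R4 => c₀ + c₁ * ‖x‖ ^ 2 + greenDeriv F 0 (‖x‖ ^ 2))) x = F (‖x‖ ^ 2) := by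
  set u : R4 → ℝ := fun x => c₀ + c₁ * ‖x‖ ^ 2 + greenDeriv F 0 (‖x‖ ^ 2) with hu
  have hsmooth : ContDiff ℝ 4 u := by
    have h1 := contDiff_greenDeriv_zero hF
    have h2 := contDiff_norm_sq (E := R4) (n := 4) ℝ
    fun_prop
  refine ⟨hsmooth, ?_⟩
  have hlap : ∀ x : R4, x ≠ 0 → Laplacian.laplacian u x =
      4 * ‖x‖ ^ 2 * greenDeriv F 2 (‖x‖ ^ 2) + 8 * (c₁ + greenDeriv F 1 (‖x‖ ^ 2)) := by
    intro x hx
    have hx2 : 0 < ‖x‖ ^ 2 := pow_pos (norm_pos_iff.2 hx) 2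
    refine laplacian_comp_norm_sq (g := fun τ => c₀ + c₁ * τ + greenDeriv F 0 τ)
      (g₁ := fun τ => c₁ + greenDeriv F 1 τ) ?_ ?_
    · filter_upwards [lt_mem_nhds hx2] with τ hτ
      have := (((hasDerivAt_id τ).const_mul c₁).const_add c₀).add
        (hasDerivAt_greenDeriv hF (i := 0) (by norm_num) hτ)
      exact this.congr_deriv (by simp)
    · exact (hasDerivAt_greenDeriv hF (i := 1) (by norm_num) hx2).const_add c₁
  have hbilap : ∀ x : R4, x ≠ 0 →
      Laplacian.laplacian (Laplacian.laplacian u) x = F (‖x‖ ^ 2) := by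
    intro x hx
    have hx2 : 0 < ‖x‖ ^ 2 := pow_pos (norm_pos_iff.2 hx) 2
    have heq : Laplacian.laplacian u =ᶠ[nhds x] fun y =>
        4 * ‖y‖ ^ 2 * greenDeriv F 2 (‖y‖ ^ 2) + 8 * (c₁ + greenDeriv F 1 (‖y‖ ^ 2)) := by
      filter_upwards [isOpen_compl_singleton.mem_nhds hx] with y hy using hlap y hy
    rw [(laplacian_congr_nhds heq).eq_of_nhds]
    have hd1 : ∀ {τ : ℝ}, 0 < τ → HasDerivAt
        (fun τ => 4 * τ * greenDeriv F 2 τ + 8 * (c₁ + greenDeriv F 1 τ))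
        (4 * τ * greenDeriv F 3 τ + 12 * greenDeriv F 2 τ) τ := by
      intro τ hτ
      have h1 := hasDerivAt_greenDeriv hF (i := 1) (by norm_num) hτ
      have h2 := hasDerivAt_greenDeriv hF (i := 2) (by norm_num) hτ
      refine ((((hasDerivAt_id τ).const_mul 4).mul h2).add
        ((h1.const_add c₁).const_mul 8)).congr_deriv ?_
      simp only [id]
      ring
    rw [laplacian_comp_norm_sq
      (g := fun τ => 4 * τ * greenDeriv F 2 τ + 8 * (c₁ + greenDeriv F 1 τ))
      (g₁ := fun τ => 4 * τ * greenDeriv F 3 τ + 12 * greenDeriv F 2 τ)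
      (g₂ := 4 * ‖x‖ ^ 2 * greenDeriv F 4 (‖x‖ ^ 2) + 16 * greenDeriv F 3 (‖x‖ ^ 2))
      (by filter_upwards [lt_mem_nhds hx2] with τ hτ using hd1 hτ) ?_]
    · have := hx2.ne'
      generalize ‖x‖ ^ 2 = τ at *
      simp only [greenDeriv]
      field_simp
      ring
    · have h3 := hasDerivAt_greenDeriv hF (i := 3) (by norm_num) hx2
      have h2 := hasDerivAt_greenDeriv hF (i := 2) (by norm_num) hx2
      refine ((((hasDerivAt_id (‖x‖ ^ 2)).const_mul 4).mul h3).add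
        (h2.const_mul 12)).congr_deriv ?_
      simp only [id]
      ring
  -- The computation is valid off the origin only; continuity of both sides and density give the
  -- origin.
  have hcont : Continuous (Laplacian.laplacian (Laplacian.laplacian u)) := by
    have h2 : ContDiff ℝ 2 (Laplacian.laplacian u) :=
      ContDiff.laplacian (hsmooth.of_le (by norm_num))
    exact (ContDiff.laplacian (n := 0) (h2.of_le (by simp))).continuous
  have hF2 : Continuous fun x : R4 => F (‖x‖ ^ 2) := by fun_prop
  intro x
  exact congrFun (hcont.ext_on (dense_compl_singleton (0 : R4)) hF2
    fun y hy => hbilap y hy) x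

/-! ### Fixed points and normal solutions -/

/-- A formula without cases, from which continuity in τ can be read off. -/
lemma radialLogKernel_eq_max_min (τ : ℝ) {t : ℝ} (ht : 0 < t) : radialLogKernel τ t =
    t / 2 * Real.log (max τ t / t) + t ^ 2 / (4 * max τ t) - t / 4 + min τ t / 4 := by
  unfold radialLogKernel
  split_ifs with h
  · rw [max_eq_left h.le, min_eq_right h.le]; ring
  · rw [max_eq_right (not_lt.1 h), min_eq_left (not_lt.1 h), div_self ht.ne', Real.log_one]
    field_simp
    ring

lemma continuous_radialGreenKernel {t : ℝ} (ht : 0 < t) :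
    Continuous fun τ => radialGreenKernel τ t := by
  have hpos : ∀ τ, 0 < max τ t := fun τ => lt_max_of_lt_right ht
  unfold radialGreenKernel
  simp only [radialLogKernel_eq_max_min _ ht]
  have h1 : Continuous fun τ => Real.log (max τ t / t) :=
    Continuous.log (by fun_prop) fun τ => (div_pos (hpos τ) ht).ne'
  have h2 : Continuous fun τ => t ^ 2 / (4 * max τ t) :=
    Continuous.div (by fun_prop) (by fun_prop) fun τ => (mul_pos four_pos (hpos τ)).ne'
  fun_prop

lemma continuous_shootingMap {p ρ a : ℝ} {V : ℝ → ℝ} (hV : Measurable V)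
    (hint : IntegrableOn (radialDensity p V) (Set.Ioi 0)) : Continuous (shootingMap p ρ a V) := by
  unfold shootingMap
  refine Continuous.add (by fun_prop) (continuous_iff_continuousAt.2 fun τ₀ => ?_)
  refine continuousAt_of_dominated (bound := fun t => (|τ₀| + 1) / 32 * radialDensity p V t)
    (Filter.Eventually.of_forall fun τ =>
      ((measurable_radialGreenKernel.comp (measurable_prodMk_left (x := τ))).mul
        (measurable_radialDensity p hV)).aestronglyMeasurable) ?_ (hint.const_mul _) ?_
  · filter_upwards [Metric.ball_mem_nhds τ₀ one_pos] with τ hτ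
    filter_upwards [ae_restrict_mem measurableSet_Ioi] with t ht
    have ht : 0 < t := ht
    have h0 := radialDensity_nonneg p V ht.le
    rw [Real.norm_eq_abs, abs_of_nonneg (mul_nonneg (radialGreenKernel_nonneg ht) h0)]
    refine mul_le_mul_of_nonneg_right ?_ h0
    rw [Metric.mem_ball, Real.dist_eq] at hτ
    have h1 := (abs_lt.1 hτ).2
    have h2 := le_abs_self τ₀
    rcases le_total 0 τ with h | h
    · exact (radialGreenKernel_le h ht).trans (by linarith)
    · rw [radialGreenKernel_of_le (h.trans ht.le)]
      positivity
  · filter_upwards [ae_restrict_mem measurableSet_Ioi] with t ht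
    exact ((continuous_radialGreenKernel ht).mul continuous_const).continuousAt

lemma weight_mul_exp_eq_radialDensity (p : ℝ) {u : R4 → ℝ} {V : ℝ → ℝ}
    (h : ∀ x, u x = V (‖x‖ ^ 2)) (x : R4) :
    (1 + ‖x‖ ^ p) * Real.exp (4 * u x) = radialDensity p V (‖x‖ ^ 2) := by
  unfold radialDensity
  rw [← Real.rpow_natCast_mul (norm_nonneg x), h]
  congr 3
  push_cast
  ring

/-- The radial solution with `Δ u → 0` at infinity is a classical normal solution. -/
lemma IsShootingSol.isNormalSolution {p ρ a : ℝ} (hp : 0 < p) {U : ℝ → ℝ}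
    (hU : IsShootingSol p ρ a U)
    (ha : a + 1 / 4 * (∫ t in Set.Ioi (0 : ℝ), radialDensity p U t) = 0) :
    IsClassicalSolution (fun x => 1 + ‖x‖ ^ p) (fun x : R4 => shootingMap p ρ a U (‖x‖ ^ 2)) ∧
      IsNormalSolution (fun x => 1 + ‖x‖ ^ p) (fun x : R4 => shootingMap p ρ a U (‖x‖ ^ 2)) := by
  -- U is only measurable and solves the equation only for τ ≥ 0; its image W is continuous on ℝ and
  -- agrees with U there.
  set W := shootingMap p ρ a U with hW
  have hWc : Continuous W := continuous_shootingMap hU.measurable hU.integrable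
  have hFc : Continuous (radialDensity p W) := by
    have : Continuous fun t : ℝ => t ^ (p / 2) := Real.continuous_rpow_const (by positivity)
    unfold radialDensity
    fun_prop
  have hFeq : Set.EqOn (radialDensity p U) (radialDensity p W) (Set.Ioi 0) := by
    intro t ht
    simp only [radialDensity, hU.eq t (le_of_lt ht), hW]
  have hswap : ∀ k : ℝ → ℝ, ∫ t in Set.Ioi (0 : ℝ), k t * radialDensity p U t =
      ∫ t in Set.Ioi (0 : ℝ), k t * radialDensity p W t := fun k =>
    setIntegral_congr_fun measurableSet_Ioi fun t ht => by simp only [hFeq ht]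
  have hdens := weight_mul_exp_eq_radialDensity p (u := fun x : R4 => W (‖x‖ ^ 2)) fun _ => rfl
  have hint : Integrable fun y : R4 => radialDensity p W (‖y‖ ^ 2) := by
    rw [integrable_comp_norm_sq_iff]
    refine (hU.integrableOn_mul hp ha).congr_fun (fun t ht => ?_) measurableSet_Ioi
    simp only [hFeq ht]
  have hker := integrable_log_kernel hFc.measurable (fun R => by
    obtain ⟨C, hC⟩ := (isCompact_Icc (a := 0) (b := R)).exists_bound_of_continuousOn
      hFc.continuousOn
    exact ⟨C, fun t h0 h1 => hC t ⟨h0, h1⟩⟩) hint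
  constructor
  · have hrep : (fun x : R4 => W (‖x‖ ^ 2)) = fun x : R4 =>
        ρ + a / 8 * ‖x‖ ^ 2 + greenDeriv (radialDensity p W) 0 (‖x‖ ^ 2) := by
      ext x
      simp only [greenDeriv]
      rw [← hswap, hW, shootingMap]
      ring
    have h := bilaplacian_greenDeriv hFc ρ (a / 8)
    rw [← hrep] at h
    exact ⟨h.1, fun x => by rw [h.2 x]; exact (hdens x).symm⟩
  · refine ⟨?_, fun x => ?_, ρ, fun x => ?_⟩
    · simpa only [hdens] using hint
    · simpa only [hdens] using hker x
    · simp only [hdens]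
      rw [integral_log_potential hFc.measurable x (hker x), hW,
        shootingMap_eq_of_mass_eq hU.integrable ha (by positivity), ← hW, hswap]
      have := Real.pi_ne_zero
      field_simp
      ring

/-- Replacing the density by a measurable representative leaves the integral unchanged for every x,
and the resulting parametric integral is measurable in x. -/
lemma IsNormalSolution.measurable {K v : R4 → ℝ} (hv : IsNormalSolution K v) : Measurable v := by
  obtain ⟨c, hc⟩ := hv.integral_eq
  set f : R4 → ℝ := hv.integrable.1.mk _ with hf
  have hfm : StronglyMeasurable f := hv.integrable.1.stronglyMeasurable_mk
  have hfm' : Measurable f := hfm.measurable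
  have hae : (fun y => K y * Real.exp (4 * v y)) =ᵐ[volume] f := hv.integrable.1.ae_eq_mk
  have hrep : v = fun x => 1 / (8 * Real.pi ^ 2) *
      (∫ y : R4, Real.log (‖y‖ / ‖x - y‖) * f y) + c := by
    ext x
    rw [hc x]
    congr 2
    refine integral_congr_ae ?_
    filter_upwards [hae] with y hy
    rw [hy]
  have hjoint : Measurable fun q : R4 × R4 => Real.log (‖q.2‖ / ‖q.1 - q.2‖) * f q.2 := by
    fun_prop
  have := (hjoint.stronglyMeasurable.integral_prod_right' (ν := (volume : Measure R4))).measurable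
  rw [hrep]
  fun_prop

/-- A radial normal solution is a fixed point of the shooting map. -/
lemma IsNormalSolution.exists_shootingSol {p ρ : ℝ} (hp : 0 < p) {v : R4 → ℝ}
    (hv : IsNormalSolution (fun x => 1 + ‖x‖ ^ p) v) (hrad : IsRadial v) (hv0 : v 0 = ρ) :
    ∃ a V, IsShootingSol p ρ a V ∧
      a + 1 / 4 * (∫ t in Set.Ioi (0 : ℝ), radialDensity p V t) = 0 ∧
      ∀ x, v x = V (‖x‖ ^ 2) := by
  set V : ℝ → ℝ := fun τ => v (EuclideanSpace.single 0 (Real.sqrt τ)) with hV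
  have hVm : Measurable V := by
    refine hv.measurable.comp ?_
    have : Continuous fun s : ℝ => (EuclideanSpace.single 0 s : R4) := by
      have h : (fun s : ℝ => (EuclideanSpace.single 0 s : R4)) =
          fun s => s • (EuclideanSpace.single 0 (1 : ℝ) : R4) := by
        ext s i; simp
      rw [h]; fun_prop
    exact this.measurable.comp Real.continuous_sqrt.measurable
  have hvV : ∀ x, v x = V (‖x‖ ^ 2) := fun x =>
    hrad _ _ (by simp [Real.sqrt_sq (norm_nonneg x)])
  have hdens := weight_mul_exp_eq_radialDensity p hvV
  have hFm := measurable_radialDensity p hVm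
  have hc : ∀ x : R4, v x = 1 / (8 * Real.pi ^ 2) *
      (∫ y : R4, Real.log (‖y‖ / ‖x - y‖) * radialDensity p V (‖y‖ ^ 2)) + ρ := by
    obtain ⟨c, hc⟩ := hv.integral_eq
    simp only [hdens] at hc
    have h0 := hc 0
    -- At x = 0 the kernel vanishes identically, so the additive constant must be `v 0`.
    have hz : ∀ y : R4, Real.log (‖y‖ / ‖0 - y‖) = 0 := by
      intro y
      rw [zero_sub, norm_neg]
      rcases eq_or_ne ‖y‖ 0 with h | h
      · simp [h]
      · rw [div_self h, Real.log_one]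
    simp only [hz, zero_mul, integral_zero, mul_zero, zero_add] at h0
    rw [← hv0, h0]
    exact hc
  have hker := hv.integrable_kernel
  simp only [hdens] at hker
  have hVeq : ∀ τ, 0 ≤ τ → V τ =
      ρ - 1 / 8 * ∫ t in Set.Ioi (0 : ℝ), radialLogKernel τ t * radialDensity p V t := by
    intro τ hτ
    have hn : ‖(EuclideanSpace.single 0 (Real.sqrt τ) : R4)‖ ^ 2 = τ := by
      simp [Real.sq_sqrt hτ]
    have h := hc (EuclideanSpace.single 0 (Real.sqrt τ))
    rw [integral_log_potential hFm _ (hker _), hn] at h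
    simp only [hV]
    rw [h]
    have := Real.pi_ne_zero
    field_simp
    ring
  have hVle : ∀ τ, 0 ≤ τ → V τ ≤ ρ := by
    intro τ hτ
    rw [hVeq τ hτ]
    have : 0 ≤ ∫ t in Set.Ioi (0 : ℝ), radialLogKernel τ t * radialDensity p V t :=
      setIntegral_nonneg measurableSet_Ioi fun t ht =>
        mul_nonneg (radialLogKernel_nonneg hτ ht) (radialDensity_nonneg p V (le_of_lt ht))
    linarith
  have htF : IntegrableOn (fun t => t * radialDensity p V t) (Set.Ioi 0) := by
    rw [← integrable_comp_norm_sq_iff]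
    simpa only [hdens] using hv.integrable
  -- Normality controls only ∫ t F(t) dt. On (0, 1] the density is bounded since V ≤ ρ, and beyond 1
  -- it is at most t F(t).
  have hFint : IntegrableOn (radialDensity p V) (Set.Ioi 0) := by
    rw [← Set.Ioc_union_Ioi_eq_Ioi (zero_le_one (α := ℝ))]
    refine IntegrableOn.union ?_ ?_
    · refine Measure.integrableOn_of_bounded (M := 2 * Real.exp (4 * ρ)) (by simp)
        hFm.aestronglyMeasurable ?_
      filter_upwards [ae_restrict_mem measurableSet_Ioc] with t ht
      rw [Real.norm_eq_abs, abs_of_nonneg (radialDensity_nonneg p V ht.1.le)]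
      have h1 : t ^ (p / 2) ≤ 1 := Real.rpow_le_one ht.1.le ht.2 (by positivity)
      have h2 := hVle t ht.1.le
      unfold radialDensity
      gcongr
      linarith
    · refine Integrable.mono' (htF.mono_set (Set.Ioi_subset_Ioi zero_le_one))
        hFm.aestronglyMeasurable ?_
      filter_upwards [ae_restrict_mem measurableSet_Ioi] with t ht
      have ht : 1 < t := ht
      have h0 := radialDensity_nonneg p V (zero_le_one.trans ht.le)
      rw [Real.norm_eq_abs, abs_of_nonneg h0]
      nlinarith
  have hmass : -(1 / 4 * ∫ t in Set.Ioi (0 : ℝ), radialDensity p V t) +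
      1 / 4 * (∫ t in Set.Ioi (0 : ℝ), radialDensity p V t) = 0 := neg_add_cancel _
  refine ⟨_, V, ⟨hVm, hFint, fun τ hτ => ?_, hmass.le⟩, hmass, hvV⟩
  rw [shootingMap_eq_of_mass_eq hFint hmass hτ, hVeq τ hτ]

/-- Fixed points of the shooting map with `Δ u → 0` at infinity are unique: the comparison
principle orders two of them, and the integral representation reverses this order. -/
lemma IsShootingSol.eq_of_mass_eq {p ρ a b : ℝ} (hp : 0 < p) {U V : ℝ → ℝ}
    (hU : IsShootingSol p ρ a U)
    (ha : a + 1 / 4 * (∫ t in Set.Ioi (0 : ℝ), radialDensity p U t) = 0)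
    (hV : IsShootingSol p ρ b V)
    (hb : b + 1 / 4 * (∫ t in Set.Ioi (0 : ℝ), radialDensity p V t) = 0) {τ : ℝ} (hτ : 0 ≤ τ) :
    U τ = V τ := by
  wlog hab : a ≤ b generalizing a b U V
  · exact (this hV hb hU ha (not_le.1 hab).le).symm
  have hle := hU.mono hp hV hab
  refine (hle τ hτ).antisymm ?_
  rw [hU.eq τ hτ, hV.eq τ hτ, shootingMap_eq_of_mass_eq hU.integrable ha hτ,
    shootingMap_eq_of_mass_eq hV.integrable hb hτ]
  have : ∫ t in Set.Ioi (0 : ℝ), radialLogKernel τ t * radialDensity p U t ≤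
      ∫ t in Set.Ioi (0 : ℝ), radialLogKernel τ t * radialDensity p V t :=
    setIntegral_mono_on (integrableOn_radialLogKernel_mul hτ hU.integrable)
      (integrableOn_radialLogKernel_mul hτ hV.integrable) measurableSet_Ioi fun t ht =>
        mul_le_mul_of_nonneg_left (radialDensity_mono p (le_of_lt ht) (hle t (le_of_lt ht)))
          (radialLogKernel_nonneg hτ ht)
  linarith

/-- For every `p > 0` and `ρ`, there is a radially symmetric normal solution `u` of
`Δ² u = (1 + |x|^p) e^{4u}` on `ℝ⁴` with `u 0 = ρ`. It solves the equation classically, and it is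
unique among all functions that are radially symmetric normal solutions with value `ρ` at `0`. -/
theorem theorem6p1 (p : ℝ) (hp : 0 < p) (ρ : ℝ) :
    ∃ u : R4 → ℝ,
      (IsClassicalSolution (fun x => 1 + ‖x‖ ^ p) u ∧
        IsNormalSolution (fun x => 1 + ‖x‖ ^ p) u ∧ IsRadial u ∧ u 0 = ρ) ∧
      ∀ v : R4 → ℝ,
        IsNormalSolution (fun x => 1 + ‖x‖ ^ p) v → IsRadial v → v 0 = ρ → v = u := by
  obtain ⟨a, U, hU, ha⟩ := exists_shootingSol_mass_eq hp ρ
  obtain ⟨hclass, hnormal⟩ := hU.isNormalSolution hp ha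
  refine ⟨fun x => shootingMap p ρ a U (‖x‖ ^ 2), ⟨hclass, hnormal, fun x y hxy => ?_, ?_⟩,
    fun v hv hrad hv0 => ?_⟩
  · simp only [hxy]
  · have h := shootingMap_eq_of_mass_eq (ρ := ρ) hU.integrable ha le_rfl
    have hz : ∫ t in Set.Ioi (0 : ℝ), radialLogKernel 0 t * radialDensity p U t = 0 := by
      refine setIntegral_eq_zero_of_forall_eq_zero fun t ht => ?_
      rw [radialLogKernel, if_neg (not_lt.2 (le_of_lt ht)), zero_div, zero_mul]
    rw [hz, mul_zero, sub_zero] at h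
    simpa using h
  · obtain ⟨b, V, hV, hb, hvV⟩ := hv.exists_shootingSol hp hrad hv0
    ext x
    have hx : 0 ≤ ‖x‖ ^ 2 := by positivity
    rw [hvV x, hV.eq_of_mass_eq hp hb hU ha hx, hU.eq _ hx]
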